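/- **Negative binomial batch sizes.** Consider an open network of $J$ infinite server queues. Batches arrive at the points $T_1,T_2,\dots$ of a non-homogeneous Poisson process on $[0,\infty)$ with non-negative, locally integrable rate $\lambda$. The $i$-th batch brings $\Sigma_{ij}$ customers to queue $j$, where the vectors $\boldsymbol\Sigma_i=(\Sigma_{i1},\dots,\Sigma_{iJ})$ are i.i.d. copies of a random vector $\mathbf S$ in $\mathbb Z_{\ge0}^J$. The $\ell$-th customer of batch $i$ entering at queue $j$ carries a stochastic process $X^j_{i,\ell}$, where $X^j_{i,\ell}(s)=k$ means that this customer is in queue $k$ at time $T_i+s$ (a customer may also be outside the network), and $P(X^j_{i,\ell}(s)=k)=q^j_k(s)$ for all $s\ge 0$. Each $X^j_{i,\ell}$ is jointly measurable in time and in its own randomness (for instance, it has right-continuous paths). The arrival process, all the batch vectors and all the processes $X^j_{i,\ell}$ are mutually independent. Let $$N_k(t)=\sum_{i:\,T_i\le t}\ \sum_{j=1}^J\ \sum_{\ell=1}^{\Sigma_{ij}}\mathbf 1\{X^j_{i,\ell}(t-T_i)=k\}$$ be the number of customers in queue $k$ at time $t$, and $\mathbf N(t)=(N_1(t),\dots,N_J(t))$.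 Suppose that $$\mathbb E\Big[\prod_{j=1}^J z_j^{S_j}\Big]=G\Big(\sum_{j=1}^J p_jz_j\Big)\quad(|z_1|,\dots,|z_J|\le1),\qquad p_j\ge0,\quad \sum_{j=1}^J p_j=1,$$ where $G$ is the probability generating function of a negative binomial random variable $S$, that is, $$G(z)=\mathbb E[z^S]=\frac1{[1+\nu(1-z)]^r}\quad(|z|\le 1),\qquad \nu>0,\ r>0.$$ Put $q_k(s)=\sum_{j=1}^J p_j\,q^j_k(s)$. Then for every $t\ge0$, every $v\in\{1,\dots,J\}$ and all non-negative integers $n_1,\dots,n_v$ with $n_v\ge1$, $$\begin{aligned}P\big[&\mathbf N(t)=(n_1,\dots,n_v,0,\dots,0)\big]\\&=\sum_{i_1=0}^{n_1}\cdots\sum_{i_{v-1}=0}^{n_{v-1}}\sum_{i_v=1}^{n_v}\Bigg[\frac{i_v}{n_v}\,P\big[\mathbf N(t)=(n_1-i_1,\dots,n_v-i_v,0,\dots,0)\big]\\&\qquad\cdot\int_0^t\lambda(\tau)\,\frac{\Gamma\big(r+\sum_{k=1}^v i_k\big)}{\Gamma(r)\prod_{k=1}^v i_k!}\,\frac{\nu^{\sum_{k=1}^v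 i_k}}{\big[1+\nu\sum_{k=1}^J q_k(t-\tau)\big]^{r+\sum_{k=1}^v i_k}}\prod_{k=1}^v q_k(t-\tau)^{i_k}\,d\tau\Bigg],\end{aligned}$$ where all the integrands are integrable on $[0,t]$. -/

import Mathlib

open MeasureTheory ProbabilityTheory
open scoped ENNReal NNReal

namespace BatchQueue

/-- The number of arrival epochs in `A ⊆ [0, ∞)`. The epochs are `T 0, T 1, …`, and the value
`T i ω = ∞` means that there is no `i`-th arrival. -/
noncomputable def arrivalCount {Ω : Type*} (T : ℕ → Ω → ℝ≥0∞) (A : Set ℝ) (ω : Ω) : ℕ∞ :=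
  {i : ℕ | ∃ s ∈ A, T i ω = ENNReal.ofReal s}.encard

/-- `T 0, T 1, …` are the points of a non-homogeneous Poisson process on `[0, ∞)` with rate
function `lam`: the numbers of points in disjoint bounded Borel sets are independent, and the number
of points in `A` is Poisson distributed with mean `∫_A lam`. -/
structure IsPoissonArrivals {Ω : Type*} [MeasurableSpace Ω] (P : Measure Ω)
    (lam : ℝ → ℝ) (T : ℕ → Ω → ℝ≥0∞) : Prop where
  rate_nonneg : ∀ s, 0 ≤ s → 0 ≤ lam s
  rate_integrable : ∀ t, 0 ≤ t → IntegrableOn lam (Set.Icc 0 t)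
  measurable : ∀ i, Measurable (T i)
  poisson : ∀ (A : Set ℝ) (t : ℝ), MeasurableSet A → A ⊆ Set.Icc 0 t → ∀ n : ℕ,
    P.real {ω | arrivalCount T A ω = n}
      = Real.exp (-∫ s in A, lam s) * (∫ s in A, lam s) ^ n / (n.factorial : ℝ)
  indep : ∀ (m : ℕ) (A : Fin m → Set ℝ) (t : ℝ), (∀ a, MeasurableSet (A a)) →
    (∀ a, A a ⊆ Set.Icc 0 t) → Pairwise (fun a b => Disjoint (A a) (A b)) →
    iIndepFun (fun a => arrivalCount T (A a)) P

/-- The σ-algebra generated by a process with values in `Option (Fin J)`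
(`some k` is queue `k`, `none` is "outside the network"). -/
@[reducible] def pathAlgebra {Ω : Type*} {J : ℕ} (Y : ℝ≥0 → Ω → Option (Fin J)) : MeasurableSpace Ω :=
  ⨆ s, MeasurableSpace.comap (Y s) ⊤

/-- The independent sources of randomness: the arrival epochs as a whole, the `i`-th batch vector,
and the route of the `l`-th customer of the `i`-th batch who enters at queue `j`. -/
inductive Source (J : ℕ) where
  | arrivals : Source J
  | batch (i : ℕ) : Source J
  | customer (i : ℕ) (j : Fin J) (l : ℕ) : Source J

/-- The σ-algebra generated by each source of randomness. -/
@[reducible] def sourceAlgebra {Ω : Type*} {J : ℕ} (T : ℕ → Ω → ℝ≥0∞) (B : ℕ → Ω → Fin J → ℕ)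
    (X : ℕ → Fin J → ℕ → ℝ≥0 → Ω → Option (Fin J)) : Source J → MeasurableSpace Ω
  | .arrivals => ⨆ i, MeasurableSpace.comap (T i) inferInstance
  | .batch i => MeasurableSpace.comap (B i) inferInstance
  | .customer i j l => pathAlgebra (X i j l)

/-- The open network of `J` infinite server queues with batch arrivals. `T i` is the epoch of the
`i`-th batch, `B i ω j` the number of its customers entering at queue `j`, and `X i j l s ω` the
location, `s` time units after arrival, of the `l`-th of them (customers are numbered from `0`, so
only `l < B i ω j` refers to an actual customer). `batchLaw` is the common law of the batch vectors,
and `q j k s` the probability that a customer who entered at queue `j` is in queue `k` after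
time `s`. -/
structure IsBatchNetwork {Ω : Type*} [MeasurableSpace Ω] (P : Measure Ω) {J : ℕ}
    (lam : ℝ → ℝ) (batchLaw : Measure (Fin J → ℕ)) (q : Fin J → Fin J → ℝ → ℝ)
    (T : ℕ → Ω → ℝ≥0∞) (B : ℕ → Ω → Fin J → ℕ)
    (X : ℕ → Fin J → ℕ → ℝ≥0 → Ω → Option (Fin J)) : Prop where
  arrivals : IsPoissonArrivals P lam T
  batch_measurable : ∀ i, Measurable (B i)
  batch_law : ∀ i, P.map (B i) = batchLaw
  route_measurable : ∀ i j l s k, MeasurableSet {ω | X i j l s ω = some k}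
  /-- Each route is a measurable process: it is jointly measurable in time and in the randomness
  that it generates itself (automatic for right-continuous paths). -/
  route_jointly_measurable : ∀ i j l k,
    MeasurableSet[(inferInstance : MeasurableSpace ℝ≥0).prod (pathAlgebra (X i j l))]
      {x : ℝ≥0 × Ω | X i j l x.1 x.2 = some k}
  route_law : ∀ i j l k (s : ℝ≥0), P.real {ω | X i j l s ω = some k} = q j k s
  indep : iIndep (sourceAlgebra T B X) P

/-- `C_{i,k}(s)`: the number of customers of the `i`-th batch who are in queue `k`, `s` time units
after the arrival of the batch. -/
def batchOccupancy {Ω : Type*} {J : ℕ} (B : ℕ → Ω → Fin J → ℕ)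
    (X : ℕ → Fin J → ℕ → ℝ≥0 → Ω → Option (Fin J)) (i : ℕ) (k : Fin J) (s : ℝ≥0) (ω : Ω) : ℕ :=
  ∑ j : Fin J, ∑ l ∈ Finset.range (B i ω j), if X i j l s ω = some k then 1 else 0

/-- `N_k(t)`: the number of customers in queue `k` at time `t`. -/
noncomputable def occupancy {Ω : Type*} {J : ℕ} (T : ℕ → Ω → ℝ≥0∞) (B : ℕ → Ω → Fin J → ℕ)
    (X : ℕ → Fin J → ℕ → ℝ≥0 → Ω → Option (Fin J)) (k : Fin J) (t : ℝ≥0) (ω : Ω) : ℝ≥0∞ :=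
  open Classical in
  ∑' i : ℕ, if T i ω ≤ t then (batchOccupancy B X i k (t - (T i ω).toNNReal) ω : ℝ≥0∞) else 0

/-- The probability `P[N(t) = n]`. -/
noncomputable def occupancyPMF {Ω : Type*} [MeasurableSpace Ω] (P : Measure Ω) {J : ℕ}
    (T : ℕ → Ω → ℝ≥0∞) (B : ℕ → Ω → Fin J → ℕ)
    (X : ℕ → Fin J → ℕ → ℝ≥0 → Ω → Option (Fin J)) (t : ℝ≥0) (n : Fin J → ℕ) : ℝ :=
  P.real {ω | ∀ k, occupancy T B X k t ω = (n k : ℝ≥0∞)}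

/-- The probability generating function of a law on `ℕ`. -/
noncomputable def pgf (μ : Measure ℕ) (z : ℂ) : ℂ := ∫ s, z ^ s ∂μ

/-- The probability generating function of a law on `ℕ^J`. -/
noncomputable def multiPGF {J : ℕ} (μ : Measure (Fin J → ℕ)) (z : Fin J → ℂ) : ℂ :=
  ∫ s, ∏ j, z j ^ s j ∂μ

/-- The negative binomial law, given through its generating function `[1 + ν (1 - z)]^(-r)`. -/
def IsNegBinomial (μ : Measure ℕ) (ν r : ℝ) : Prop :=
  ∀ z : ℂ, ‖z‖ ≤ 1 → pgf μ z = 1 / (1 + (ν : ℂ) * (1 - z)) ^ (r : ℂ)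

/-- The law of the vector of entry counts when a batch of random size with law `μ` arrives and each
of its customers independently enters at queue `j` with probability `p j`. -/
def IsUnivariateBatch {J : ℕ} (batchLaw : Measure (Fin J → ℕ)) (μ : Measure ℕ) (p : Fin J → ℝ) :
    Prop :=
  ∀ z : Fin J → ℂ, (∀ j, ‖z j‖ ≤ 1) → multiPGF batchLaw z = pgf μ (∑ j, (p j : ℂ) * z j)

/-- `q_k(s)`: the probability that a customer is in queue `k`, `s` time units after arrival. -/
def mixedOccupancy {J : ℕ} (p : Fin J → ℝ) (q : Fin J → Fin J → ℝ → ℝ) (k : Fin J) (s : ℝ) : ℝ :=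
  ∑ j, p j * q j k s

/-- The negative binomial kernel for queues `1, …, v`, as a function of the probabilities
`a k = q_k(s)`. -/
noncomputable def negBinomialKernel {J : ℕ} (ν r : ℝ) (v : Fin J) (i : Fin J → ℕ)
    (a : Fin J → ℝ) : ℝ :=
  Real.Gamma (r + ∑ k ∈ Finset.Iic v, (i k : ℝ))
      / (Real.Gamma r * ∏ k ∈ Finset.Iic v, ((i k).factorial : ℝ))
    * (ν ^ (∑ k ∈ Finset.Iic v, i k)
      / (1 + ν * ∑ k, a k) ^ (r + ∑ k ∈ Finset.Iic v, (i k : ℝ)))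
    * ∏ k ∈ Finset.Iic v, a k ^ i k

end BatchQueue

/-! Given the arrival epochs, distinct batches contribute independent vectors. The conditional
generating function of `N(t)` is therefore the product of `f (T i)` over the arrived batches, where
`f τ` generates the occupancy of one batch of age `t - τ`. Averaging over the Poisson process
formally gives `F = exp (∫ λ (f - 1))`. The operator `X_v ∂/∂X_v` multiplies `F` by `∫ λ · X_v
∂f/∂X_v`, and comparing coefficients of `X^n` gives `n_v P[N = n] = ∑ i_v P[N = n - i] ∫ λ · coeff i
f`. This is the asserted recursion once the coefficients of `f` are known.

The exponential formula is not proved as such; only its logarithmic derivative is used. If `f` takes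
finitely many values, the arrivals at which each value is taken have independent Poisson counts, so
the expected product splits into factors whose logarithmic derivatives come from
`eulerOp_poissonMix` and add up by `eulerOp_prod`. General `f` follows by rounding its coefficients
and dominated convergence (`IsPoissonArrivals.recursion`). The link with the queues is
`IsBatchNetwork.occupancyPMF_eq_integral`.

For the coefficients, conditioning on the batch vector turns the batch generating function into `[1
+ ν ∑ q_k (1 - z_k)]^(-r)` on the unit cube. Repeated partial differentiation identifies its
coefficients as negative multinomial (`IsBatchNetwork.measureReal_batchOccupancy`). -/

namespace BatchQueue

/-! ### Formal power series: Euler operator, sub-probability series, Poisson mixtures -/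

open MvPowerSeries Finset in
/-- The Euler operator `X_v ∂/∂X_v`. -/
def eulerOp {σ : Type*} (v : σ) (f : MvPowerSeries σ ℝ) : MvPowerSeries σ ℝ :=
  fun n => (n v : ℝ) * coeff n f

section PowerSeries

open MvPowerSeries Finset

variable {σ : Type*}

theorem coeff_eulerOp (v : σ) (f : MvPowerSeries σ ℝ) (n : σ →₀ ℕ) :
    coeff n (eulerOp v f) = (n v : ℝ) * coeff n f := rfl

/-- The weight `n v` is additive along each antidiagonal pair, which is the Leibniz rule. -/
theorem eulerOp_mul (v : σ) (f g : MvPowerSeries σ ℝ) :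
    eulerOp v (f * g) = eulerOp v f * g + f * eulerOp v g := by
  classical
  ext n
  rw [map_add, coeff_eulerOp, coeff_mul, coeff_mul, coeff_mul, ← sum_add_distrib, mul_sum]
  refine sum_congr rfl fun p hp => ?_
  rw [coeff_eulerOp, coeff_eulerOp, ← mem_antidiagonal.1 hp, Finsupp.add_apply]
  push_cast
  ring

theorem eulerOp_one (v : σ) : eulerOp v (1 : MvPowerSeries σ ℝ) = 0 := by
  classical
  ext n
  rw [coeff_eulerOp, coeff_one]
  split_ifs with h <;> simp [h]

theorem eulerOp_pow_succ (v : σ) (f : MvPowerSeries σ ℝ) (m : ℕ) :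
    eulerOp v (f ^ (m + 1)) = ((m : ℝ) + 1) • (f ^ m * eulerOp v f) := by
  induction m with
  | zero => simp
  | succ m ih =>
    rw [pow_succ, eulerOp_mul, ih]
    simp only [smul_eq_C_mul, map_add, map_one, Nat.cast_add, Nat.cast_one]
    ring

/-- Logarithmic derivatives add. Writing the hypothesis as a product avoids inverting any series. -/
theorem eulerOp_prod {ι : Type*} (v : σ) (s : Finset ι) (F h : ι → MvPowerSeries σ ℝ)
    (hF : ∀ a ∈ s, eulerOp v (F a) = F a * h a) :
    eulerOp v (∏ a ∈ s, F a) = (∏ a ∈ s, F a) * ∑ a ∈ s, h a := by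
  classical
  induction s using Finset.induction_on with
  | empty => simp [eulerOp_one]
  | insert a s ha ih =>
    rw [prod_insert ha, sum_insert ha, eulerOp_mul, hF a (mem_insert_self a s),
      ih fun b hb => hF b (mem_insert_of_mem hb)]
    ring

/-- The power series is the generating function of a sub-probability law. -/
structure IsSubProb (f : MvPowerSeries σ ℝ) : Prop where
  nonneg : ∀ n, 0 ≤ coeff n f
  sum_le : ∀ s : Finset (σ →₀ ℕ), ∑ n ∈ s, coeff n f ≤ 1

theorem IsSubProb.coeff_le_one {f : MvPowerSeries σ ℝ} (hf : IsSubProb f) (n : σ →₀ ℕ) :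
    coeff n f ≤ 1 := by
  simpa using hf.sum_le {n}

theorem IsSubProb.norm_coeff_le_one {f : MvPowerSeries σ ℝ} (hf : IsSubProb f) (n : σ →₀ ℕ) :
    ‖coeff n f‖ ≤ 1 := by
  rw [Real.norm_of_nonneg (hf.nonneg n)]
  exact hf.coeff_le_one n

theorem isSubProb_one : IsSubProb (1 : MvPowerSeries σ ℝ) := by
  classical
  refine ⟨fun n => ?_, fun s => ?_⟩
  · rw [coeff_one]; split_ifs <;> norm_num
  · simp_rw [coeff_one]
    rw [sum_ite_eq']
    split_ifs <;> norm_num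

/-- Antidiagonals of distinct indices are disjoint and their finite union lies in a rectangle, so a
partial sum of the convolution is at most a product of two partial sums. -/
theorem IsSubProb.mul {f g : MvPowerSeries σ ℝ} (hf : IsSubProb f) (hg : IsSubProb g) :
    IsSubProb (f * g) := by
  classical
  refine ⟨fun n => ?_, fun s => ?_⟩
  · rw [coeff_mul]
    exact sum_nonneg fun p _ => mul_nonneg (hf.nonneg _) (hg.nonneg _)
  · have hinj : Set.PairwiseDisjoint (s : Set (σ →₀ ℕ)) fun n => antidiagonal n := by
      intro a _ b _ hab
      refine disjoint_left.2 fun p hpa hpb => hab ?_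
      rw [← mem_antidiagonal.1 hpa, ← mem_antidiagonal.1 hpb]
    set S := s.biUnion fun n => antidiagonal n with hS
    calc ∑ n ∈ s, coeff n (f * g)
        = ∑ p ∈ S, coeff p.1 f * coeff p.2 g := by
          rw [hS, sum_biUnion hinj]
          exact sum_congr rfl fun n _ => coeff_mul _ _ _
      _ ≤ ∑ p ∈ S.image Prod.fst ×ˢ S.image Prod.snd, coeff p.1 f * coeff p.2 g := by
          refine sum_le_sum_of_subset_of_nonneg (fun p hp => ?_)
            fun p _ _ => mul_nonneg (hf.nonneg _) (hg.nonneg _)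
          exact mem_product.2 ⟨mem_image_of_mem _ hp, mem_image_of_mem _ hp⟩
      _ = (∑ a ∈ S.image Prod.fst, coeff a f) * ∑ b ∈ S.image Prod.snd, coeff b g := by
          rw [sum_mul_sum, sum_product]
      _ ≤ 1 * 1 := mul_le_mul (hf.sum_le _) (hg.sum_le _)
          (sum_nonneg fun b _ => hg.nonneg b) zero_le_one
      _ = 1 := one_mul 1

theorem IsSubProb.prod {ι : Type*} (s : Finset ι) {f : ι → MvPowerSeries σ ℝ}
    (hf : ∀ i ∈ s, IsSubProb (f i)) : IsSubProb (∏ i ∈ s, f i) :=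
  Finset.prod_induction _ IsSubProb (fun _ _ => IsSubProb.mul) isSubProb_one hf

theorem IsSubProb.pow {f : MvPowerSeries σ ℝ} (hf : IsSubProb f) (m : ℕ) : IsSubProb (f ^ m) := by
  have := IsSubProb.prod (range m) (f := fun _ => f) fun _ _ => hf
  rwa [prod_const, card_range] at this

/-- The Poisson weights. -/
noncomputable def poissonWeight (x : ℝ) (m : ℕ) : ℝ := Real.exp (-x) * x ^ m / (m.factorial : ℝ)

theorem summable_poissonWeight (x : ℝ) : Summable (poissonWeight x) := by
  have := (Real.summable_pow_div_factorial x).mul_left (Real.exp (-x))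
  refine this.congr fun m => ?_
  rw [poissonWeight, mul_div_assoc]

theorem poissonWeight_succ (x : ℝ) (m : ℕ) :
    poissonWeight x (m + 1) * ((m : ℝ) + 1) = x * poissonWeight x m := by
  have : (m.factorial : ℝ) ≠ 0 := by exact_mod_cast m.factorial_ne_zero
  have : (m : ℝ) + 1 ≠ 0 := by positivity
  simp only [poissonWeight, Nat.factorial_succ, Nat.cast_mul, Nat.cast_add, Nat.cast_one]
  field_simp
  ring

/-- The generating function of a random sum of a Poisson number of terms, coefficient by
coefficient. -/
noncomputable def poissonMix (x : ℝ) (g : MvPowerSeries σ ℝ) : MvPowerSeries σ ℝ :=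
  fun n => ∑' m, poissonWeight x m * coeff n (g ^ m)

theorem coeff_poissonMix (x : ℝ) (g : MvPowerSeries σ ℝ) (n : σ →₀ ℕ) :
    coeff n (poissonMix x g) = ∑' m, poissonWeight x m * coeff n (g ^ m) := rfl

theorem summable_poissonMix (x : ℝ) {g : MvPowerSeries σ ℝ} (hg : IsSubProb g) (n : σ →₀ ℕ) :
    Summable fun m => poissonWeight x m * coeff n (g ^ m) := by
  refine Summable.of_norm_bounded (summable_poissonWeight x).norm fun m => ?_
  rw [norm_mul]
  exact mul_le_of_le_one_right (norm_nonneg _) ((hg.pow m).norm_coeff_le_one n)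

/-- Formally the mixture is `exp (x (g - 1))`. Since `g` may have a non-zero constant term, the
argument runs coefficientwise with convergent sums: differentiating `g ^ (m + 1)` produces the
factor `m + 1`, which shifts the Poisson weight. -/
theorem eulerOp_poissonMix (v : σ) (x : ℝ) {g : MvPowerSeries σ ℝ} (hg : IsSubProb g) :
    eulerOp v (poissonMix x g) = poissonMix x g * (x • eulerOp v g) := by
  classical
  ext n
  rw [coeff_eulerOp, coeff_poissonMix, ← tsum_mul_left]
  have h0 : ∀ m, (n v : ℝ) * (poissonWeight x m * coeff n (g ^ m))
      = poissonWeight x m * coeff n (eulerOp v (g ^ m)) := fun m => by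
    rw [coeff_eulerOp]; ring
  have hs := (summable_poissonMix x hg n).mul_left (n v : ℝ)
  -- The term `m = 0` dies because the Euler operator kills constants; the others are reindexed by
  -- `m + 1`.
  rw [hs.tsum_eq_zero_add, h0 0, pow_zero, eulerOp_one, map_zero, mul_zero, zero_add, coeff_mul]
  have h1 : ∀ m, (n v : ℝ) * (poissonWeight x (m + 1) * coeff n (g ^ (m + 1)))
      = ∑ p ∈ antidiagonal n, (poissonWeight x m * coeff p.1 (g ^ m)) *
          coeff p.2 (x • eulerOp v g) := fun m => by
    rw [h0, eulerOp_pow_succ, coeff_smul, ← mul_assoc, poissonWeight_succ, coeff_mul, mul_sum]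
    refine sum_congr rfl fun p _ => ?_
    rw [coeff_smul]
    ring
  simp_rw [h1]
  rw [Summable.tsum_finsetSum fun p _ => (summable_poissonMix x hg p.1).mul_right _]
  exact sum_congr rfl fun p _ => by rw [tsum_mul_right, coeff_poissonMix]

end PowerSeries

/-! ### Poisson arrivals: counts, their law and almost sure finiteness -/

section Arrivals

variable {Ω : Type*}

theorem exists_mem_ofReal_iff {A : Set ℝ} (hA : ∀ s ∈ A, 0 ≤ s) (x : ℝ≥0∞) :
    (∃ s ∈ A, x = ENNReal.ofReal s) ↔ x ≠ ∞ ∧ x.toReal ∈ A := by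
  constructor
  · rintro ⟨s, hs, rfl⟩
    rw [ENNReal.toReal_ofReal (hA s hs)]
    exact ⟨ENNReal.ofReal_ne_top, hs⟩
  · rintro ⟨hx, hs⟩
    exact ⟨_, hs, (ENNReal.ofReal_toReal hx).symm⟩

/-- Seen in `ℝ≥0∞` the count is a series of indicators. The embedding of the countable type `ℕ∞` is
injective, so its fibres are measurable. -/
theorem measurable_arrivalCount [MeasurableSpace Ω] {T : ℕ → Ω → ℝ≥0∞}
    (hT : ∀ i, Measurable (T i)) {A : Set ℝ} (hA : MeasurableSet A) (hA0 : ∀ s ∈ A, 0 ≤ s) :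
    Measurable (arrivalCount T A) := by
  classical
  have hS : ∀ i, MeasurableSet {ω | ∃ s ∈ A, T i ω = ENNReal.ofReal s} := fun i => by
    simp_rw [exists_mem_ofReal_iff hA0]
    exact ((measurableSet_singleton ∞).compl.preimage (hT i)).inter
      (hA.preimage (hT i).ennreal_toReal)
  have hm : Measurable fun ω => ((arrivalCount T A ω : ℕ∞) : ℝ≥0∞) := by
    have : (fun ω => ((arrivalCount T A ω : ℕ∞) : ℝ≥0∞)) = fun ω =>
        ∑' i, ({ω | ∃ s ∈ A, T i ω = ENNReal.ofReal s}).indicator (fun _ => (1 : ℝ≥0∞)) ω := by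
      funext ω
      rw [arrivalCount, ← ENNReal.tsum_set_one, tsum_subtype _ fun _ => (1 : ℝ≥0∞)]
      rfl
    rw [this]
    exact Measurable.tsum fun i => measurable_const.indicator (hS i)
  refine measurable_to_countable' fun y => ?_
  convert hm (measurableSet_singleton (y : ℝ≥0∞)) using 1
  ext ω
  simp

open Classical in
/-- The indices of the batches that have arrived by time `t`
(empty if there are infinitely many). -/
noncomputable def arrivedBatches (T : ℕ → Ω → ℝ≥0∞) (t : ℝ≥0) (ω : Ω) : Finset ℕ :=
  if h : {i | T i ω ≤ t}.Finite then h.toFinset else ∅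

theorem mem_arrivedBatches {T : ℕ → Ω → ℝ≥0∞} {t : ℝ≥0} {ω : Ω} (h : {i | T i ω ≤ t}.Finite)
    {i : ℕ} : i ∈ arrivedBatches T t ω ↔ T i ω ≤ t := by
  rw [arrivedBatches, dif_pos h]
  simp

theorem mem_Icc_toReal_iff {x : ℝ≥0∞} {t : ℝ≥0} :
    (∃ s ∈ Set.Icc (0 : ℝ) t, x = ENNReal.ofReal s) ↔ x ≤ t := by
  rw [exists_mem_ofReal_iff fun s hs => hs.1]
  constructor
  · rintro ⟨hx, h⟩
    rw [← ENNReal.ofReal_toReal hx, ← ENNReal.ofReal_coe_nnreal]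
    exact ENNReal.ofReal_le_ofReal h.2
  · intro h
    refine ⟨ne_top_of_le_ne_top ENNReal.coe_ne_top h, ENNReal.toReal_nonneg, ?_⟩
    simpa using ENNReal.toReal_mono ENNReal.coe_ne_top h

theorem iIndepFun_arrivalCount [MeasurableSpace Ω] {P : Measure Ω}
    {lam : ℝ → ℝ} {T : ℕ → Ω → ℝ≥0∞} (h : IsPoissonArrivals P lam T) {κ : Type*} [Fintype κ]
    (A : κ → Set ℝ) (t : ℝ) (hA : ∀ a, MeasurableSet (A a)) (hAt : ∀ a, A a ⊆ Set.Icc 0 t)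
    (hd : Pairwise fun a b => Disjoint (A a) (A b)) :
    iIndepFun (fun a => arrivalCount T (A a)) P := by
  let e := Fintype.equivFin κ
  have := (h.indep _ (fun i => A (e.symm i)) t (fun _ => hA _) (fun _ => hAt _)
    fun i j hij => hd (e.symm.injective.ne hij)).precomp e.injective
  simpa using this

variable [MeasurableSpace Ω] {P : Measure Ω} [IsProbabilityMeasure P]
  {lam : ℝ → ℝ} {T : ℕ → Ω → ℝ≥0∞}

omit [IsProbabilityMeasure P] in
theorem IsPoissonArrivals.setIntegral_nonneg (h : IsPoissonArrivals P lam T) {A : Set ℝ} {t : ℝ}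
    (hA : MeasurableSet A) (hAt : A ⊆ Set.Icc 0 t) : 0 ≤ ∫ s in A, lam s :=
  MeasureTheory.setIntegral_nonneg hA fun s hs => h.rate_nonneg s (hAt hs).1

theorem IsPoissonArrivals.measure_arrivalCount (h : IsPoissonArrivals P lam T) {A : Set ℝ} {t : ℝ}
    (hA : MeasurableSet A) (hAt : A ⊆ Set.Icc 0 t) (n : ℕ) :
    P {ω | arrivalCount T A ω = n} = poissonMeasure (∫ s in A, lam s).toNNReal {n} := by
  rw [poissonMeasure_singleton, Real.coe_toNNReal _ (h.setIntegral_nonneg hA hAt),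
    ← h.poisson A t hA hAt n, measureReal_def, ENNReal.ofReal_toReal (measure_ne_top _ _)]

/-- The Poisson weights of the finite values already sum to one, leaving no mass for `⊤`. -/
theorem IsPoissonArrivals.ae_arrivalCount_ne_top (h : IsPoissonArrivals P lam T) {A : Set ℝ} {t : ℝ}
    (hA : MeasurableSet A) (hAt : A ⊆ Set.Icc 0 t) : ∀ᵐ ω ∂P, arrivalCount T A ω ≠ ⊤ := by
  have hm := measurable_arrivalCount h.measurable hA fun s hs => (hAt hs).1
  have hms : ∀ n : ℕ, MeasurableSet {ω | arrivalCount T A ω = n} := fun n =>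
    hm (measurableSet_singleton (n : ℕ∞))
  have h1 : P (⋃ n : ℕ, {ω | arrivalCount T A ω = n}) = 1 := by
    rw [measure_iUnion (fun m n hmn => ?_) hms]
    · simp_rw [h.measure_arrivalCount hA hAt]
      rw [← measure_iUnion (fun m n hmn => by simpa using hmn) fun n => measurableSet_singleton n,
        Set.iUnion_of_singleton, measure_univ]
    · refine Set.disjoint_left.2 fun ω h1 h2 => hmn ?_
      simp only [Set.mem_ofPred_eq] at h1 h2
      exact_mod_cast h1.symm.trans h2
  have h2 := (prob_compl_eq_zero_iff (MeasurableSet.iUnion hms)).2 h1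
  filter_upwards [compl_mem_ae_iff.2 h2] with ω hω
  rw [compl_compl, Set.mem_iUnion] at hω
  obtain ⟨n, hn⟩ := hω
  rw [show arrivalCount T A ω = n from hn]
  exact ENat.natCast_ne_top n

theorem IsPoissonArrivals.map_arrivalCount (h : IsPoissonArrivals P lam T) {A : Set ℝ} {t : ℝ}
    (hA : MeasurableSet A) (hAt : A ⊆ Set.Icc 0 t) :
    P.map (fun ω => (arrivalCount T A ω).toNat) = poissonMeasure (∫ s in A, lam s).toNNReal := by
  have hm := measurable_arrivalCount h.measurable hA fun s hs => (hAt hs).1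
  refine Measure.ext_of_singleton fun n => ?_
  rw [Measure.map_apply (f := fun ω => (arrivalCount T A ω).toNat)
    ((Measurable.of_discrete (f := ENat.toNat)).comp hm) (measurableSet_singleton n), ← h.measure_arrivalCount hA hAt]
  -- `ENat.toNat` sends `⊤` to `0`, so the events agree only up to a null set.
  refine measure_congr (Filter.eventuallyEq_set.2 ?_)
  filter_upwards [h.ae_arrivalCount_ne_top hA hAt] with ω hω
  rw [Set.mem_preimage, Set.mem_singleton_iff]
  refine ⟨fun h1 => ?_, fun h1 => ?_⟩
  · rw [← ENat.natCast_toNat hω, h1]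
  · rw [h1, ENat.toNat_natCast]

theorem IsPoissonArrivals.ae_finite (h : IsPoissonArrivals P lam T) (t : ℝ≥0) :
    ∀ᵐ ω ∂P, {i | T i ω ≤ t}.Finite := by
  filter_upwards [h.ae_arrivalCount_ne_top (t := t) measurableSet_Icc subset_rfl] with ω hω
  rw [arrivalCount, Set.encard_ne_top_iff] at hω
  simpa only [mem_Icc_toReal_iff] using hω

/-! ### Expected products over the arrived batches -/

open MvPowerSeries Finset

variable {σ : Type*}

theorem IsPoissonArrivals.integral_coeff_pow (h : IsPoissonArrivals P lam T) {A : Set ℝ} {t : ℝ}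
    (hA : MeasurableSet A) (hAt : A ⊆ Set.Icc 0 t) {g : MvPowerSeries σ ℝ} (hg : IsSubProb g)
    (n : σ →₀ ℕ) :
    ∫ ω, coeff n (g ^ (arrivalCount T A ω).toNat) ∂P
      = coeff n (poissonMix (∫ s in A, lam s) g) := by
  have hm := measurable_arrivalCount h.measurable hA fun s hs => (hAt hs).1
  rw [← integral_map (φ := fun ω => (arrivalCount T A ω).toNat) (f := fun m => coeff n (g ^ m))
    ((Measurable.of_discrete (f := ENat.toNat)).comp hm).aemeasurable
    (by fun_prop), h.map_arrivalCount hA hAt, integral_poissonMeasure', coeff_poissonMix,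
    Real.coe_toNNReal _ (h.setIntegral_nonneg hA hAt)]
  · rfl
  · exact Integrable.of_bound (by fun_prop) 1
      (Filter.Eventually.of_forall fun m => (hg.pow m).norm_coeff_le_one n)

theorem measurableSet_fiber [Finite σ] {f : ℝ → MvPowerSeries σ ℝ}
    (hf : ∀ n, Measurable fun s => coeff n (f s)) (g : MvPowerSeries σ ℝ) :
    MeasurableSet (f ⁻¹' {g}) := by
  have : f ⁻¹' {g} = ⋂ n, {s | coeff n (f s) = coeff n g} := by
    ext s
    simp [MvPowerSeries.ext_iff]
  rw [this]
  exact MeasurableSet.iInter fun n => hf n (measurableSet_singleton _)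

omit [MeasurableSpace Ω] in
/-- For a finite-valued family, the product over the arrived batches groups into powers. -/
theorem prod_arrivedBatches_eq {f : ℝ → MvPowerSeries σ ℝ} {κ : Type*} [Fintype κ]
    (φ : ℝ → κ) (g : κ → MvPowerSeries σ ℝ) (hφ : ∀ s, f s = g (φ s)) {t : ℝ≥0} {ω : Ω}
    (hω : {i | T i ω ≤ t}.Finite) :
    ∏ i ∈ arrivedBatches T t ω, f (T i ω).toReal
      = ∏ a, g a ^ (arrivalCount T (Set.Icc 0 (t : ℝ) ∩ φ ⁻¹' {a}) ω).toNat := by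
  classical
  simp_rw [hφ]
  rw [← prod_fiberwise' (arrivedBatches T t ω) (fun i => φ (T i ω).toReal) g]
  refine prod_congr rfl fun a _ => ?_
  rw [prod_const]
  congr 1
  have : {i | ∃ s ∈ Set.Icc 0 (t : ℝ) ∩ φ ⁻¹' {a}, T i ω = ENNReal.ofReal s}
      = ((arrivedBatches T t ω).filter fun i => φ (T i ω).toReal = a : Finset ℕ) := by
    ext i
    rw [Set.mem_ofPred_eq, exists_mem_ofReal_iff fun s hs => hs.1.1, mem_coe, mem_filter,
      mem_arrivedBatches hω, ← mem_Icc_toReal_iff, exists_mem_ofReal_iff fun s hs => hs.1]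
    simp only [Set.mem_inter_iff, Set.mem_preimage, Set.mem_singleton_iff]
    tauto
  rw [arrivalCount, this, Set.encard_coe_eq_coe_finsetCard, ENat.toNat_natCast]

/-- The recursion for the coefficients of the expected product over the arrived batches. -/
def HasPoissonRecursion (P : Measure Ω) (lam : ℝ → ℝ) (T : ℕ → Ω → ℝ≥0∞) (t : ℝ≥0) (v : σ)
    (f : ℝ → MvPowerSeries σ ℝ) (n : σ →₀ ℕ) : Prop :=
  open Classical in
  (n v : ℝ) * ∫ ω, coeff n (∏ i ∈ arrivedBatches T t ω, f (T i ω).toReal) ∂P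
    = ∑ p ∈ antidiagonal n,
        (∫ ω, coeff p.1 (∏ i ∈ arrivedBatches T t ω, f (T i ω).toReal) ∂P) *
          ((p.2 v : ℝ) * ∫ s in Set.Icc 0 (t : ℝ), lam s * coeff p.2 (f s))

/-- The fibres of `f` cut `[0, t]` into finitely many disjoint sets with independent Poisson counts,
so the expected product is a finite product of Poisson mixtures. Measurability is recorded alongside
because the later passage to the limit needs it. -/
theorem IsPoissonArrivals.recursion_of_finite_range [Finite σ] (h : IsPoissonArrivals P lam T)
    {f : ℝ → MvPowerSeries σ ℝ} (hf : ∀ n, Measurable fun s => coeff n (f s))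
    (hf1 : ∀ s, IsSubProb (f s)) (hfin : (Set.range f).Finite) (t : ℝ≥0) :
    (∀ n, AEStronglyMeasurable
      (fun ω => coeff n (∏ i ∈ arrivedBatches T t ω, f (T i ω).toReal)) P) ∧
    ∀ v n, HasPoissonRecursion P lam T t v f n := by
  classical
  have : Fintype (Set.range f) := hfin.fintype
  let φ := Set.rangeFactorization f
  let g : Set.range f → MvPowerSeries σ ℝ := Subtype.val
  have hφ : ∀ s, f s = g (φ s) := fun s => rfl
  let A : Set.range f → Set ℝ := fun a => Set.Icc 0 (t : ℝ) ∩ φ ⁻¹' {a}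
  have hAt : ∀ a, A a ⊆ Set.Icc 0 (t : ℝ) := fun a => Set.inter_subset_left
  have hA : ∀ a, MeasurableSet (A a) := fun a => by
    refine measurableSet_Icc.inter ?_
    convert measurableSet_fiber hf a.1 using 1
    ext s
    simp [φ, Subtype.ext_iff]
  have hd : Pairwise fun a b => Disjoint (A a) (A b) := fun a b hab =>
    Set.disjoint_left.2 fun s ha hb => hab (ha.2.symm.trans hb.2)
  have hg : ∀ a : Set.range f, IsSubProb (g a) := by
    rintro ⟨_, s, rfl⟩
    exact hf1 s
  let M : Set.range f → Ω → ℕ := fun a ω => (arrivalCount T (A a) ω).toNat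
  have hM : ∀ a, Measurable (M a) := fun a => (Measurable.of_discrete (f := ENat.toNat)).comp
    (measurable_arrivalCount h.measurable (hA a) fun s hs => (hAt a hs).1)
  have hMind : iIndepFun M P := (iIndepFun_arrivalCount h A t hA hAt hd).comp
    (fun _ => ENat.toNat) fun _ => Measurable.of_discrete
  let F : Set.range f → MvPowerSeries σ ℝ := fun a => poissonMix (∫ s in A a, lam s) (g a)
  have hae : ∀ n, (fun ω => coeff n (∏ i ∈ arrivedBatches T t ω, f (T i ω).toReal)) =ᵐ[P]
      fun ω => ∑ l ∈ finsuppAntidiag univ n, ∏ a, coeff (l a) ((g a) ^ M a ω) :=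
      fun n => by
    filter_upwards [h.ae_finite t] with ω hω
    rw [prod_arrivedBatches_eq φ g hφ hω, coeff_prod]
  have hmeas1 : ∀ (l : Set.range f →₀ σ →₀ ℕ) a,
      Measurable fun ω => coeff (l a) ((g a) ^ M a ω) := fun l a =>
    (Measurable.of_discrete (f := fun m : ℕ => coeff (l a) ((g a) ^ m))).comp
      (hM a)
  have hmeas : ∀ l : Set.range f →₀ σ →₀ ℕ,
      Measurable fun ω => ∏ a, coeff (l a) ((g a) ^ M a ω) := fun l =>
    Finset.measurable_fun_prod _ fun a _ => hmeas1 l a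
  -- `coeff_prod` is used twice: to expand into products of functions of the independent counts,
  -- then to reassemble the expectations.
  have hint : ∀ n, ∫ ω, coeff n (∏ i ∈ arrivedBatches T t ω, f (T i ω).toReal) ∂P
      = coeff n (∏ a, F a) := fun n => by
    rw [integral_congr_ae (hae n), integral_finsetSum, coeff_prod]
    · refine sum_congr rfl fun l _ => ?_
      rw [hMind.integral_fun_prod_comp (f := fun a m => coeff (l a) ((g a) ^ m))
        (fun a => (hM a).aemeasurable) fun a => by fun_prop]
      exact prod_congr rfl fun a _ => h.integral_coeff_pow (hA a) (hAt a) (hg a) _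
    · intro l _
      refine Integrable.of_bound (hmeas l).aestronglyMeasurable 1
        (Filter.Eventually.of_forall fun ω => ?_)
      rw [norm_prod]
      exact prod_le_one (fun _ _ => norm_nonneg _)
        fun a _ => ((hg a).pow _).norm_coeff_le_one _
  refine ⟨fun n => ?_, fun v n => ?_⟩
  · refine (Measurable.aestronglyMeasurable ?_).congr (hae n).symm
    exact Finset.measurable_fun_sum _ fun l _ => hmeas l
  -- On each fibre the coefficient is constant, so the rate integral becomes the finite sum that
  -- `eulerOp_prod` produces.
  · have hrate : ∀ b : σ →₀ ℕ, ∫ s in Set.Icc 0 (t : ℝ), lam s * coeff b (f s)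
        = ∑ a : Set.range f, (∫ s in A a, lam s) * coeff b (g a) := fun b => by
      have hU : Set.Icc 0 (t : ℝ) = ⋃ a, A a := by
        ext s
        simp only [A, Set.mem_iUnion, Set.mem_inter_iff, Set.mem_preimage, Set.mem_singleton_iff,
          exists_and_left, exists_eq', and_true]
      have hc : ∀ a, Set.EqOn (fun s => lam s * coeff b (f s))
          (fun s => lam s * coeff b (g a)) (A a) := fun a s hs => by
        have : φ s = a := hs.2
        simp only [hφ, this]
      have hi : ∀ a, IntegrableOn (fun s => lam s * coeff b (f s)) (A a) := fun a =>
        (IntegrableOn.congr_fun (((h.rate_integrable t t.2).mono_set (hAt a)).mul_const _)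
          (hc a).symm (hA a))
      rw [hU, integral_iUnion_fintype hA hd hi]
      exact sum_congr rfl fun a _ => by
        rw [setIntegral_congr_fun (hA a) (hc a), integral_mul_const]
    rw [HasPoissonRecursion, hint, ← coeff_eulerOp, eulerOp_prod v univ F
      (fun a => (∫ s in A a, lam s) • eulerOp v (g a))
      (fun a _ => eulerOp_poissonMix v _ (hg a)), coeff_mul]
    refine sum_congr rfl fun p _ => ?_
    rw [hint, map_sum, hrate]
    congr 1
    rw [mul_sum]
    refine sum_congr rfl fun a _ => ?_
    rw [coeff_smul, coeff_eulerOp]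
    ring

/-- Rounding of the coefficients to multiples of `1 / N`, and truncation. -/
noncomputable def roundDown [Finite σ] (N : ℕ) (f : MvPowerSeries σ ℝ) : MvPowerSeries σ ℝ :=
  open Classical in
  fun n => if n ≤ Finsupp.equivFunOnFinite.symm (fun _ => N) then
    (⌊coeff n f * N⌋₊ : ℝ) / N else 0

open Classical in
theorem coeff_roundDown [Finite σ] (N : ℕ) (f : MvPowerSeries σ ℝ) (n : σ →₀ ℕ) :
    coeff n (roundDown N f) = if n ≤ Finsupp.equivFunOnFinite.symm (fun _ => N) then
      (⌊coeff n f * N⌋₊ : ℝ) / N else 0 := rfl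

theorem IsSubProb.roundDown [Finite σ] (N : ℕ) {f : MvPowerSeries σ ℝ} (hf : IsSubProb f) :
    IsSubProb (roundDown N f) := by
  classical
  refine ⟨fun n => ?_, fun s => (sum_le_sum fun n _ => ?_).trans (hf.sum_le s)⟩
  · rw [coeff_roundDown]
    split_ifs <;> positivity
  · rw [coeff_roundDown]
    split_ifs
    · refine div_le_of_le_mul₀ N.cast_nonneg (hf.nonneg n) ?_
      exact Nat.floor_le (mul_nonneg (hf.nonneg n) N.cast_nonneg)
    · exact hf.nonneg n

/-- Only the coefficients in a finite box survive, and each lies in `[0, 1]`, leaving `N + 1`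
possible numerators. -/
theorem finite_range_roundDown [Finite σ] (N : ℕ) {f : ℝ → MvPowerSeries σ ℝ}
    (hf : ∀ s, IsSubProb (f s)) : (Set.range fun s => roundDown N (f s)).Finite := by
  classical
  let b : σ →₀ ℕ := Finsupp.equivFunOnFinite.symm (fun _ => N)
  let mk : (Finset.Iic b → Fin (N + 1)) → MvPowerSeries σ ℝ := fun k n =>
    if h : n ∈ Finset.Iic b then ((k ⟨n, h⟩ : ℕ) : ℝ) / N else 0
  refine (Set.finite_range mk).subset ?_
  rintro _ ⟨s, rfl⟩
  refine ⟨fun n => ⟨⌊coeff n.1 (f s) * N⌋₊, Nat.lt_succ_of_le ?_⟩, ?_⟩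
  · refine Nat.floor_le_of_le ?_
    exact mul_le_of_le_one_left N.cast_nonneg ((hf s).coeff_le_one _)
  · ext n
    rw [coeff_roundDown]
    change (if h : n ∈ Finset.Iic b then _ else _) = _
    simp only [Finset.mem_Iic, b]
    split_ifs <;> rfl

theorem tendsto_coeff_roundDown [Finite σ] {f : MvPowerSeries σ ℝ} (hf : IsSubProb f)
    (n : σ →₀ ℕ) : Filter.Tendsto (fun N => coeff n (roundDown N f)) Filter.atTop
      (nhds (coeff n f)) := by
  classical
  refine ((tendsto_nat_floor_mul_div_atTop (hf.nonneg n)).comp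
    tendsto_natCast_atTop_atTop).congr' ?_
  have : Fintype σ := Fintype.ofFinite σ
  -- Every entry of `n` is at most the total, so such an `N` puts `n` inside the box.
  filter_upwards [Filter.eventually_ge_atTop (∑ k, n k)] with N hN
  rw [coeff_roundDown, if_pos]
  · rfl
  · intro k
    exact (single_le_sum (f := fun k => n k) (fun _ _ => Nat.zero_le _) (mem_univ k)).trans hN

open MvPowerSeries.WithPiTopology in
theorem tendsto_coeff_prod_roundDown [Finite σ] {f : ℝ → MvPowerSeries σ ℝ}
    (hf : ∀ s, IsSubProb (f s)) (I : Finset ℕ) (x : ℕ → ℝ) (n : σ →₀ ℕ) :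
    Filter.Tendsto (fun N => coeff n (∏ i ∈ I, roundDown N (f (x i)))) Filter.atTop
      (nhds (coeff n (∏ i ∈ I, f (x i)))) := by
  refine (tendsto_iff_coeff_tendsto _ _ _).1 (tendsto_finsetProd I fun i _ => ?_) n
  exact (tendsto_iff_coeff_tendsto _ _ _).2 (tendsto_coeff_roundDown (hf _))

/-- Each side involves finitely many integrals, so the recursion passes to the limit of the rounded
series. The dominating functions are `1` on the probability space and `‖lam‖` on `[0, t]`. -/
theorem IsPoissonArrivals.recursion [Finite σ] (h : IsPoissonArrivals P lam T)
    {f : ℝ → MvPowerSeries σ ℝ} (hf : ∀ n, Measurable fun s => coeff n (f s))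
    (hf1 : ∀ s, IsSubProb (f s)) (t : ℝ≥0) (v : σ) (n : σ →₀ ℕ) :
    HasPoissonRecursion P lam T t v f n := by
  classical
  have hmeas : ∀ N n, Measurable fun s => coeff n (roundDown N (f s)) := fun N n => by
    simp_rw [coeff_roundDown]
    split_ifs
    · exact ((measurable_from_nat (f := fun m : ℕ => (m : ℝ))).comp
        (Nat.measurable_floor.comp ((hf n).mul_const _))).div_const _
    · exact measurable_const
  have key := fun N => h.recursion_of_finite_range (hmeas N) (fun s => (hf1 s).roundDown N)
    (finite_range_roundDown N hf1) t
  have hE : ∀ n, Filter.Tendsto (fun N => ∫ ω, coeff n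
      (∏ i ∈ arrivedBatches T t ω, roundDown N (f (T i ω).toReal)) ∂P) Filter.atTop
      (nhds (∫ ω, coeff n (∏ i ∈ arrivedBatches T t ω, f (T i ω).toReal) ∂P)) := fun n =>
    tendsto_integral_of_dominated_convergence (fun _ => 1) (fun N => (key N).1 n)
      (integrable_const 1)
      (fun N => Filter.Eventually.of_forall fun ω =>
        (IsSubProb.prod _ fun i _ => (hf1 _).roundDown N).norm_coeff_le_one n)
      (Filter.Eventually.of_forall fun ω => tendsto_coeff_prod_roundDown hf1 _ _ n)
  have hlam := h.rate_integrable t t.2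
  have hR : ∀ b, Filter.Tendsto (fun N => ∫ s in Set.Icc 0 (t : ℝ),
      lam s * coeff b (roundDown N (f s))) Filter.atTop
      (nhds (∫ s in Set.Icc 0 (t : ℝ), lam s * coeff b (f s))) := fun b => by
    refine tendsto_integral_of_dominated_convergence (fun s => ‖lam s‖)
      (fun N => hlam.aestronglyMeasurable.mul (hmeas N b).aestronglyMeasurable) hlam.norm
      (fun N => Filter.Eventually.of_forall fun s => ?_)
      (Filter.Eventually.of_forall fun s => (tendsto_coeff_roundDown (hf1 s) b).const_mul _)
    rw [norm_mul]
    exact mul_le_of_le_one_right (norm_nonneg _) (((hf1 s).roundDown N).norm_coeff_le_one b)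
  refine tendsto_nhds_unique ((hE n).const_mul (n v : ℝ)) ?_
  refine Filter.Tendsto.congr (fun N => ((key N).2 v n).symm) ?_
  exact tendsto_finsetSum _ fun p _ => (hE p.1).mul ((hR p.2).const_mul _)

end Arrivals

/-! ### Taylor coefficients of negative powers of an affine form -/

section Coefficients

open Finset

/-- The terms `m (x / y) ^ m` of a convergent series are bounded by its sum. This pays for the
factor created by termwise differentiation. -/
theorem exists_mul_pow_le {x y : ℝ} (hx : 0 < x) (hxy : x < y) :
    ∃ K : ℝ, ∀ m : ℕ, (m : ℝ) * x ^ (m - 1) ≤ K * y ^ m := by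
  have hy : 0 < y := hx.trans hxy
  have hr : ‖x / y‖ < 1 := by
    rw [Real.norm_of_nonneg (by positivity)]
    exact (div_lt_one hy).2 hxy
  have hs := summable_pow_mul_geometric_of_norm_lt_one 1 hr
  refine ⟨(∑' m : ℕ, (m : ℝ) ^ 1 * (x / y) ^ m) / x, fun m => ?_⟩
  have h1 : (m : ℝ) ^ 1 * (x / y) ^ m ≤ ∑' m : ℕ, (m : ℝ) ^ 1 * (x / y) ^ m :=
    hs.le_tsum m fun _ _ => by positivity
  rcases m with _ | m
  · simp only [CharP.cast_eq_zero, zero_mul, pow_zero, mul_one]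
    exact div_nonneg (tsum_nonneg fun _ => by positivity) hx.le
  · rw [div_mul_eq_mul_div, le_div_iff₀ hx, Nat.add_sub_cancel]
    rw [pow_one, div_pow, ← mul_div_assoc, div_le_iff₀ (by positivity)] at h1
    calc _ = ((m + 1 : ℕ) : ℝ) * x ^ (m + 1) := by ring
      _ ≤ _ := h1

variable {σ : Type*} [Fintype σ] [DecidableEq σ]

theorem prod_update_pow (z : σ → ℝ) (k : σ) (x : ℝ) (a : σ → ℕ) :
    ∏ j, Function.update z k x j ^ a j = x ^ a k * ∏ j ∈ univ.erase k, z j ^ a j := by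
  rw [← mul_prod_erase univ _ (mem_univ k), Function.update_self]
  congr 1
  exact prod_congr rfl fun j hj => by rw [Function.update_of_ne (ne_of_mem_erase hj)]

theorem prod_add_single {M : Type*} [CommMonoid M] (F : σ → ℕ → M) (a : σ → ℕ) (k : σ) :
    ∏ j, F j ((a + Pi.single k 1 : σ → ℕ) j) = F k (a k + 1) * ∏ j ∈ univ.erase k, F j (a j) := by
  rw [← mul_prod_erase univ _ (mem_univ k)]
  congr 1
  · simp
  · exact prod_congr rfl fun j hj => by simp [ne_of_mem_erase hj]

omit [Fintype σ] in
theorem exists_eq_add_single {a : σ → ℕ} {k : σ} (hk : a k ≠ 0) :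
    ∃ a' : σ → ℕ, a = a' + Pi.single k 1 := by
  refine ⟨a - Pi.single k 1, ?_⟩
  funext j
  rcases eq_or_ne j k with rfl | hj
  · simp only [Pi.add_apply, Pi.sub_apply, Pi.single_eq_same]
    omega
  · simp [hj]

/-- Termwise partial differentiation of a power series in several variables. -/
theorem hasSum_partialDeriv {c : (σ → ℕ) → ℝ} {h : (σ → ℝ) → ℝ}
    (hc : ∀ z : σ → ℝ, (∀ k, |z k| < 1) → HasSum (fun a => c a * ∏ k, z k ^ a k) (h z))
    (k : σ) {z : σ → ℝ} (hz : ∀ k, |z k| < 1) {h' : ℝ}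
    (hd : HasDerivAt (fun x => h (Function.update z k x)) h' (z k)) :
    HasSum (fun a : σ → ℕ => ((a k : ℝ) + 1) * c (a + Pi.single k 1) * ∏ k, z k ^ a k) h' := by
  -- Two radii `|z k| < x < y < 1`: on the ball of radius `x`, the differentiated series is
  -- dominated by a multiple of the original one at radius `y`.
  obtain ⟨x, hzx, hx1⟩ := exists_between (hz k)
  obtain ⟨y, hxy, hy1⟩ := exists_between hx1
  have hx0 : 0 < x := (abs_nonneg _).trans_lt hzx
  obtain ⟨K, hK⟩ := exists_mul_pow_le hx0 hxy
  have hmem : ∀ s : ℝ, |s| < 1 → ∀ j, |Function.update z k s j| < 1 := fun s hs j => by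
    rcases eq_or_ne j k with rfl | hj
    · rwa [Function.update_self]
    · rw [Function.update_of_ne hj]
      exact hz j
  let W : (σ → ℕ) → ℝ := fun a => ∏ j ∈ univ.erase k, z j ^ a j
  have hsum : ∀ s : ℝ, |s| < 1 →
      HasSum (fun a => c a * (s ^ a k * W a)) (h (Function.update z k s)) := fun s hs => by
    simpa only [prod_update_pow] using hc _ (hmem s hs)
  let g' : (σ → ℕ) → ℝ → ℝ := fun a s => c a * ((a k : ℝ) * s ^ (a k - 1) * W a)
  have hy0 : 0 < y := hx0.trans hxy
  have hu : Summable fun a => K * ‖c a * (y ^ a k * W a)‖ :=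
    ((hsum y (by rwa [abs_of_pos hy0])).summable.norm).mul_left K
  have hder : ∀ a s, s ∈ Metric.ball (0 : ℝ) x →
      HasDerivAt (fun s => c a * (s ^ a k * W a)) (g' a s) s := fun a s _ =>
    ((hasDerivAt_pow (a k) s).mul_const (W a)).const_mul (c a)
  have hbd : ∀ a s, s ∈ Metric.ball (0 : ℝ) x → ‖g' a s‖ ≤ K * ‖c a * (y ^ a k * W a)‖ := by
    intro a s hs
    have hs' : |s| ≤ x := by simpa using (Metric.mem_ball.1 hs).le
    have h1 : ‖(a k : ℝ) * s ^ (a k - 1)‖ ≤ K * y ^ a k := by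
      rw [norm_mul, norm_pow, Real.norm_natCast]
      refine le_trans ?_ (hK (a k))
      gcongr
      exact hs'
    simp only [g', norm_mul (c a), norm_mul _ (W a)]
    rw [Real.norm_of_nonneg (pow_nonneg hy0.le _)]
    calc ‖c a‖ * (‖(a k : ℝ) * s ^ (a k - 1)‖ * ‖W a‖)
        ≤ ‖c a‖ * (K * y ^ a k * ‖W a‖) := by gcongr
      _ = _ := by ring
  have hzmem : z k ∈ Metric.ball (0 : ℝ) x := by simpa using hzx
  have hderiv := hasDerivAt_tsum_of_isPreconnected hu Metric.isOpen_ball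
    (convex_ball (0 : ℝ) x).isPreconnected hder hbd hzmem (hsum (z k) (hz k)).summable hzmem
  have heq : (fun s => ∑' a, c a * (s ^ a k * W a)) =ᶠ[nhds (z k)]
      fun s => h (Function.update z k s) := by
    filter_upwards [Metric.isOpen_ball.mem_nhds hzmem] with s hs
    refine (hsum s ?_).tsum_eq
    have : |s| < x := by simpa using hs
    exact this.trans hx1
  have hval : HasSum (fun a => g' a (z k)) h' := by
    have hS : Summable fun a => g' a (z k) := .of_norm_bounded hu fun a => hbd a _ hzmem
    have := hS.hasSum
    rwa [(hderiv.congr_of_eventuallyEq heq.symm).unique hd] at this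
  -- Derivative terms with `a k = 0` vanish, so the sum may be reindexed along the shift by one in
  -- coordinate `k`.
  have hinj : Function.Injective fun a : σ → ℕ => a + Pi.single k 1 := add_left_injective _
  rw [← hinj.hasSum_iff] at hval
  · convert hval using 1
    funext a
    simp only [g', Function.comp_apply, W]
    rw [← mul_prod_erase univ _ (mem_univ k)]
    have : ∏ j ∈ univ.erase k, z j ^ (a + Pi.single k 1 : σ → ℕ) j = ∏ j ∈ univ.erase k, z j ^ a j :=
      prod_congr rfl fun j hj => by simp [ne_of_mem_erase hj]
    rw [this]
    simp only [Pi.add_apply, Pi.single_eq_same, Nat.add_sub_cancel]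
    push_cast
    ring
  · intro a ha
    have : a k = 0 := by
      by_contra hk
      obtain ⟨a', rfl⟩ := exists_eq_add_single hk
      exact ha ⟨a', rfl⟩
    simp [g', this]

/-- The family `K (A - ∑ b_j z_j)^(-ρ)` is closed under partial derivatives, which drives the
induction on degree. -/
theorem hasDerivAt_negBinomial (K A ρ : ℝ) (b z : σ → ℝ) (k : σ) (hA : 0 < A - ∑ j, b j * z j) :
    HasDerivAt (fun x => K * (A - ∑ j, b j * Function.update z k x j) ^ (-ρ))
      (K * ρ * b k * (A - ∑ j, b j * z j) ^ (-(ρ + 1))) (z k) := by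
  have hlin : ∀ x, A - ∑ j, b j * Function.update z k x j
      = A - (b k * x + ∑ j ∈ univ.erase k, b j * z j) := fun x => by
    rw [← add_sum_erase univ _ (mem_univ k), Function.update_self]
    congr 2
    exact sum_congr rfl fun j hj => by rw [Function.update_of_ne (ne_of_mem_erase hj)]
  have hz : A - (b k * z k + ∑ j ∈ univ.erase k, b j * z j) = A - ∑ j, b j * z j := by
    rw [← add_sum_erase univ _ (mem_univ k)]
  have h1 : HasDerivAt (fun x => A - (b k * x + ∑ j ∈ univ.erase k, b j * z j))
      (-(b k * 1)) (z k) :=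
    (((hasDerivAt_id (z k)).const_mul (b k)).add_const _).const_sub A
  simp_rw [hlin]
  have h2 := (h1.rpow_const (p := -ρ) (Or.inl (by rw [hz]; exact hA.ne'))).const_mul K
  rw [hz] at h2
  refine h2.congr_deriv ?_
  rw [show -(ρ + 1) = -ρ - 1 by ring]
  ring

omit [DecidableEq σ] in
/-- The coefficients of the power series of `(A - ∑ b_k z_k)^(-ρ)`. -/
theorem coeff_eq_of_hasSum_negBinomial {A : ℝ} {b : σ → ℝ} (hb : ∀ k, 0 ≤ b k)
    (hA : ∑ k, b k < A) (a : σ → ℕ) : ∀ {c : (σ → ℕ) → ℝ} {K ρ : ℝ}, 0 < ρ →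
    (∀ z : σ → ℝ, (∀ k, |z k| < 1) →
      HasSum (fun a => c a * ∏ k, z k ^ a k) (K * (A - ∑ k, b k * z k) ^ (-ρ))) →
    c a = K * (Real.Gamma (ρ + ∑ k, (a k : ℝ)) / (Real.Gamma ρ * ∏ k, ((a k).factorial : ℝ))) *
      (∏ k, b k ^ a k) * A ^ (-(ρ + ∑ k, (a k : ℝ))) := by
  have hpos : ∀ z : σ → ℝ, (∀ k, |z k| < 1) → 0 < A - ∑ k, b k * z k := fun z hz => by
    have : ∑ k, b k * z k ≤ ∑ k, b k := sum_le_sum fun k _ =>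
      mul_le_of_le_one_right (hb k) ((le_abs_self _).trans (hz k).le)
    linarith
  classical
  -- Induction on the total degree, for all `c`, `K`, `ρ` at once: differentiation changes `K` to `K
  -- * ρ * b k` and `ρ` to `ρ + 1`, and `Γ(ρ + 1) = ρ Γ(ρ)` absorbs the new factor.
  obtain ⟨m, hm⟩ : ∃ m, ∑ k, a k = m := ⟨_, rfl⟩
  induction m generalizing a with
  | zero =>
    intro c K ρ hρ hc
    have ha : a = 0 := by
      funext k
      simpa using (sum_eq_zero_iff.1 hm) k (mem_univ k)
    subst ha
    -- Evaluation at the origin isolates the constant coefficient.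
    have h0 := hc 0 (by simp)
    have h1 : HasSum (fun a : σ → ℕ => c a * ∏ k, (0 : σ → ℝ) k ^ a k) (c 0) := by
      convert hasSum_single (0 : σ → ℕ) fun a ha => ?_ using 1
      · simp
      · obtain ⟨k, hk⟩ := Function.ne_iff.1 ha
        rw [prod_eq_zero (mem_univ k), mul_zero]
        simpa using hk
    rw [h1.unique h0]
    have := (Real.Gamma_pos_of_pos hρ).ne'
    simp [this]
  | succ m ih =>
    intro c K ρ hρ hc
    obtain ⟨k, -, hk⟩ : ∃ k ∈ univ, a k ≠ 0 := by
      by_contra! h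
      rw [sum_eq_zero h] at hm
      omega
    obtain ⟨a, rfl⟩ := exists_eq_add_single hk
    have hsum : ∑ j, (a + Pi.single k 1 : σ → ℕ) j = ∑ j, a j + 1 := by
      simp [sum_add_distrib]
    have hsum' : ∑ j, (((a + Pi.single k 1 : σ → ℕ) j : ℕ) : ℝ) = ∑ j, (a j : ℝ) + 1 := by
      exact_mod_cast hsum
    have key := ih a (by omega) (c := fun a => ((a k : ℝ) + 1) * c (a + Pi.single k 1))
      (K := K * ρ * b k) (ρ := ρ + 1) (by positivity) fun z hz => by
        exact hasSum_partialDeriv hc k hz (hasDerivAt_negBinomial K A ρ b z k (hpos z hz))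
    rw [hsum', prod_add_single (fun j m => b j ^ m), prod_add_single fun j m => (m.factorial : ℝ)]
    rw [← mul_prod_erase univ (fun j => b j ^ a j) (mem_univ k),
      ← mul_prod_erase univ (fun j => ((a j).factorial : ℝ)) (mem_univ k),
      Real.Gamma_add_one hρ.ne', show ρ + 1 + ∑ j, (a j : ℝ) = ρ + (∑ j, (a j : ℝ) + 1) by ring]
      at key
    have hk1 : (a k : ℝ) + 1 ≠ 0 := by positivity
    have hG := (Real.Gamma_pos_of_pos hρ).ne'
    have hF : ∏ j ∈ univ.erase k, ((a j).factorial : ℝ) ≠ 0 :=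
      prod_ne_zero_iff.2 fun j _ => by exact_mod_cast (a j).factorial_ne_zero
    have hFk : ((a k).factorial : ℝ) ≠ 0 := by exact_mod_cast (a k).factorial_ne_zero
    refine mul_left_cancel₀ hk1 (key.trans ?_)
    rw [Nat.factorial_succ]
    push_cast
    field_simp
    ring

end Coefficients

/-! ### Routes of customers and their weights -/

section Routes

variable {Ω : Type*} {J : ℕ}

theorem measurableSet_pathAlgebra (Y : ℝ≥0 → Ω → Option (Fin J)) (s : ℝ≥0) (k : Fin J) :
    MeasurableSet[pathAlgebra Y] {ω | Y s ω = some k} :=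
  (le_iSup (fun s => MeasurableSpace.comap (Y s) ⊤) s) _ ⟨{some k}, trivial, rfl⟩

/-- The state space is finite, and being outside the network is the complement of being in some
queue. -/
theorem pathAlgebra_le [m : MeasurableSpace Ω] {Y : ℝ≥0 → Ω → Option (Fin J)}
    (h : ∀ s k, MeasurableSet {ω | Y s ω = some k}) : pathAlgebra Y ≤ m := by
  refine iSup_le fun s => ?_
  rintro _ ⟨S, -, rfl⟩
  have hS : Y s ⁻¹' S = ⋃ x ∈ S, Y s ⁻¹' {x} := by
    ext ω
    simp
  rw [hS]
  refine MeasurableSet.biUnion S.toFinite.countable fun x _ => ?_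
  rcases x with _ | k
  · have : Y s ⁻¹' {none} = (⋃ k, {ω | Y s ω = some k})ᶜ := by
      ext ω
      rw [Set.mem_preimage, Set.mem_singleton_iff, Option.eq_none_iff_forall_ne_some]
      simp
    rw [this]
    exact (MeasurableSet.iUnion fun k => h s k).compl
  · exact h s k

/-- The factor `z_k` of a customer in queue `k`, and `1` outside the network. -/
def routeWeight (z : Fin J → ℝ) (x : Option (Fin J)) : ℝ := x.elim 1 z

/-- This form involves only the events of being in a given queue, whose measurability and
probabilities are given. -/
theorem routeWeight_eq (z : Fin J → ℝ) (x : Option (Fin J)) :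
    routeWeight z x = 1 + ∑ k, if x = some k then z k - 1 else 0 := by
  rcases x with _ | j <;> simp [routeWeight]

theorem prod_pow_ite (z : Fin J → ℝ) (x : Option (Fin J)) :
    ∏ k, z k ^ (if x = some k then 1 else 0) = routeWeight z x := by
  rcases x with _ | j
  · simp [routeWeight]
  · rw [Finset.prod_eq_single j]
    · simp [routeWeight]
    · intro k _ hk
      simp [hk.symm]
    · simp

theorem norm_routeWeight_le {z : Fin J → ℝ} (hz : ∀ k, |z k| ≤ 1) (x : Option (Fin J)) :
    ‖routeWeight z x‖ ≤ 1 := by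
  rcases x with _ | j
  · simp [routeWeight]
  · exact hz j

theorem measurable_routeWeight [MeasurableSpace Ω] {x : Ω → Option (Fin J)}
    (hx : ∀ k, MeasurableSet {ω | x ω = some k}) (z : Fin J → ℝ) :
    Measurable fun ω => routeWeight z (x ω) := by
  simp_rw [routeWeight_eq]
  refine measurable_const.add (Finset.measurable_fun_sum _ fun k _ => ?_)
  exact Measurable.ite (hx k) measurable_const measurable_const

/-- The number of summands is random; freeing it as a separate discrete variable leaves sums of
fixed length. -/
theorem measurable_batchOccupancy [MeasurableSpace Ω] {B : ℕ → Ω → Fin J → ℕ}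
    {X : ℕ → Fin J → ℕ → ℝ≥0 → Ω → Option (Fin J)} {i : ℕ} {s : ℝ≥0} (hB : Measurable (B i))
    (hX : ∀ j l k, MeasurableSet {ω | X i j l s ω = some k}) (k : Fin J) :
    Measurable (batchOccupancy B X i k s) := by
  change Measurable fun ω => ∑ j, ∑ l ∈ Finset.range (B i ω j),
    if X i j l s ω = some k then 1 else 0
  refine Finset.measurable_fun_sum _ fun j _ => ?_
  have hBj : Measurable fun ω => B i ω j := (measurable_pi_apply j).comp hB
  have h : Measurable fun p : Ω × ℕ =>
      ∑ l ∈ Finset.range p.2, if X i j l s p.1 = some k then 1 else 0 := by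
    refine measurable_from_prod_countable_left fun m => ?_
    change Measurable fun ω => ∑ l ∈ Finset.range m, if X i j l s ω = some k then 1 else 0
    exact Finset.measurable_fun_sum _ fun l _ =>
      Measurable.ite (hX j l k) measurable_const measurable_const
  exact h.comp (measurable_id.prodMk hBj)

theorem prod_pow_batchOccupancy (B : ℕ → Ω → Fin J → ℕ)
    (X : ℕ → Fin J → ℕ → ℝ≥0 → Ω → Option (Fin J)) (i : ℕ) (s : ℝ≥0) (ω : Ω) (z : Fin J → ℝ) :
    ∏ k, z k ^ batchOccupancy B X i k s ω
      = ∏ j, ∏ l ∈ Finset.range (B i ω j), routeWeight z (X i j l s ω) := by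
  simp_rw [batchOccupancy, ← Finset.prod_pow_eq_pow_sum, ← prod_pow_ite z]
  rw [Finset.prod_comm]
  exact Finset.prod_congr rfl fun j _ => Finset.prod_comm

end Routes

/-! ### Fubini for independent variables -/

section Independence

variable {Ω : Type*} [MeasurableSpace Ω] {P : Measure Ω} [IsProbabilityMeasure P]

/-- Independence makes the joint law a product, so one variable can be frozen while the other is
averaged. -/
theorem integral_comp_prodMk_of_indepFun {α β : Type*} [MeasurableSpace α] [MeasurableSpace β]
    {U : Ω → α} {V : Ω → β} (hU : Measurable U) (hV : Measurable V) (hUV : IndepFun U V P)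
    {Φ : α × β → ℝ} (hΦ : Measurable Φ) {c : ℝ} (hc : ∀ x, ‖Φ x‖ ≤ c) :
    ∫ ω, Φ (U ω, V ω) ∂P = ∫ ω, ∫ ω', Φ (U ω, V ω') ∂P ∂P := by
  have hprod := (indepFun_iff_map_prod_eq_prod_map_map hU.aemeasurable hV.aemeasurable).1 hUV
  have := Measure.isProbabilityMeasure_map (μ := P) hU.aemeasurable
  have := Measure.isProbabilityMeasure_map (μ := P) hV.aemeasurable
  have hint : Integrable Φ ((P.map U).prod (P.map V)) :=
    Integrable.of_bound hΦ.aestronglyMeasurable c (Filter.Eventually.of_forall hc)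
  rw [← integral_map (φ := fun ω => (U ω, V ω)) (hU.prodMk hV).aemeasurable
    hΦ.aestronglyMeasurable, hprod, integral_prod _ hint,
    integral_map hU.aemeasurable hint.integral_prod_left.aestronglyMeasurable]
  refine integral_congr_ae (Filter.Eventually.of_forall fun ω => ?_)
  exact integral_map hV.aemeasurable (hΦ.comp measurable_prodMk_left).aestronglyMeasurable

theorem measureReal_prodMk_of_indepFun {α β : Type*} [MeasurableSpace α] [MeasurableSpace β]
    {U : Ω → α} {V : Ω → β} (hU : Measurable U) (hV : Measurable V) (hUV : IndepFun U V P)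
    {D : Set (α × β)} (hD : MeasurableSet D) :
    P.real {ω | (U ω, V ω) ∈ D} = ∫ ω, P.real {ω' | (U ω, V ω') ∈ D} ∂P := by
  classical
  have h := integral_comp_prodMk_of_indepFun hU hV hUV (Φ := D.indicator 1)
    (measurable_one.indicator hD) (c := 1) fun x => by
      rw [Set.indicator_apply]
      split_ifs <;> simp
  refine (integral_indicator_one ((hU.prodMk hV) hD)).symm.trans
    (h.trans (integral_congr_ae (Filter.Eventually.of_forall fun ω => ?_)))
  exact integral_indicator_one ((measurable_prodMk_left.comp hV) hD)

omit [IsProbabilityMeasure P] in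
theorem hasSum_measureReal_fiber_mul {α : Type*} [Countable α] [MeasurableSpace α]
    [MeasurableSingletonClass α] {C : Ω → α} (hC : Measurable C) {g : α → ℝ}
    (hg : Integrable (fun ω => g (C ω)) P) :
    HasSum (fun a => P.real {ω | C ω = a} * g a) (∫ ω, g (C ω) ∂P) := by
  have hm : ∀ a, MeasurableSet (C ⁻¹' {a}) := fun a => hC (measurableSet_singleton a)
  have hU : (⋃ a, C ⁻¹' {a}) = Set.univ := by
    ext ω
    simp
  have h := hasSum_integral_iUnion (μ := P) (f := fun ω => g (C ω)) hm
    (fun a b hab => Set.disjoint_left.2 fun ω h1 h2 => hab (h1.symm.trans h2))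
    (hU ▸ hg.integrableOn)
  rw [hU, setIntegral_univ] at h
  have he : (fun a => P.real {ω | C ω = a} * g a) = fun a => ∫ ω in C ⁻¹' {a}, g (C ω) ∂P := by
    funext a
    rw [setIntegral_congr_fun (g := fun _ => g a) (hm a) fun ω hω => by
      rw [show C ω = a from hω], setIntegral_const, smul_eq_mul]
    rfl
  rwa [he]

end Independence

/-! ### Law of the occupancy of one batch -/

section BatchLaw

variable {Ω : Type*} [MeasurableSpace Ω] {P : Measure Ω} [IsProbabilityMeasure P]
  {J : ℕ} {lam : ℝ → ℝ} {batchLaw : Measure (Fin J → ℕ)} {q : Fin J → Fin J → ℝ → ℝ}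
  {T : ℕ → Ω → ℝ≥0∞} {B : ℕ → Ω → Fin J → ℕ}
  {X : ℕ → Fin J → ℕ → ℝ≥0 → Ω → Option (Fin J)}

omit [IsProbabilityMeasure P] in
theorem IsBatchNetwork.sourceAlgebra_le (hnet : IsBatchNetwork P lam batchLaw q T B X)
    (x : Source J) : sourceAlgebra T B X x ≤ ‹MeasurableSpace Ω› := by
  rcases x with _ | i | ⟨i, j, l⟩
  · exact iSup_le fun i => (hnet.arrivals.measurable i).comap_le
  · exact (hnet.batch_measurable i).comap_le
  · exact pathAlgebra_le (hnet.route_measurable i j l)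

theorem IsBatchNetwork.integral_routeWeight (hnet : IsBatchNetwork P lam batchLaw q T B X)
    (i : ℕ) (j : Fin J) (l : ℕ) (s : ℝ≥0) (z : Fin J → ℝ) :
    ∫ ω, routeWeight z (X i j l s ω) ∂P = 1 - ∑ k, q j k s * (1 - z k) := by
  simp_rw [routeWeight_eq]
  have hm := hnet.route_measurable i j l s
  have hi : ∀ k, Integrable (fun ω => if X i j l s ω = some k then z k - 1 else 0) P := fun k => by
    refine ((integrable_const (z k - 1)).indicator (hm k)).congr
      (Filter.Eventually.of_forall fun ω => ?_)
    simp only [Set.indicator_apply, Set.mem_ofPred_eq]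
  rw [integral_add (integrable_const _) (integrable_finsetSum _ fun k _ => hi k),
    integral_finsetSum _ fun k _ => hi k]
  have : ∀ k, ∫ ω, (if X i j l s ω = some k then z k - 1 else 0) ∂P = q j k s * (z k - 1) :=
    fun k => by
      rw [← hnet.route_law i j l k s, ← smul_eq_mul, ← setIntegral_const,
        ← integral_indicator (hm k)]
      simp only [Set.indicator_apply, Set.mem_ofPred_eq]
  simp_rw [this]
  rw [integral_const, probReal_univ, one_smul, sub_eq_add_neg, ← Finset.sum_neg_distrib]
  congr 1
  exact Finset.sum_congr rfl fun k _ => by ring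

omit [IsProbabilityMeasure P] in
theorem IsBatchNetwork.iIndepFun_routeWeight (hnet : IsBatchNetwork P lam batchLaw q T B X)
    (i : ℕ) (s : ℝ≥0) (z : Fin J → ℝ) :
    iIndepFun (fun (x : (_ : Fin J) × ℕ) ω => routeWeight z (X i x.1 x.2 s ω)) P := by
  rw [iIndepFun_iff_iIndep]
  have hinj : Function.Injective fun x : (_ : Fin J) × ℕ => Source.customer i x.1 x.2 := by
    rintro ⟨j, l⟩ ⟨j', l'⟩ h
    cases h
    rfl
  refine iIndep_of_iIndep_of_le (hnet.indep.precomp hinj) fun x => ?_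
  refine Measurable.comap_le (m₁ := pathAlgebra (X i x.1 x.2)) ?_
  exact @measurable_routeWeight Ω J (pathAlgebra (X i x.1 x.2)) _
    (measurableSet_pathAlgebra _ s) z

theorem IsBatchNetwork.integral_prod_routeWeight (hnet : IsBatchNetwork P lam batchLaw q T B X)
    (i : ℕ) (s : ℝ≥0) (z : Fin J → ℝ) (b : Fin J → ℕ) :
    ∫ ω, ∏ j, ∏ l ∈ Finset.range (b j), routeWeight z (X i j l s ω) ∂P
      = ∏ j, (1 - ∑ k, q j k s * (1 - z k)) ^ b j := by
  let S : Finset ((_ : Fin J) × ℕ) := Finset.univ.sigma fun j => Finset.range (b j)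
  have h := ((hnet.iIndepFun_routeWeight i s z).precomp
    (g := ((↑) : S → (_ : Fin J) × ℕ)) Subtype.val_injective).integral_fun_prod_eq_prod_integral
    fun x => (measurable_routeWeight (hnet.route_measurable i _ _ s) z).aestronglyMeasurable
  simp only [hnet.integral_routeWeight] at h
  rw [Finset.prod_coe_sort S fun x => 1 - ∑ k, q x.1 k s * (1 - z k), Finset.prod_sigma] at h
  simp_rw [Finset.prod_const, Finset.card_range] at h
  rw [← h]
  refine integral_congr_ae (Filter.Eventually.of_forall fun ω => ?_)
  change _ = ∏ x : S, routeWeight z (X i x.1.1 x.1.2 s ω)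
  rw [Finset.prod_coe_sort S fun x => routeWeight z (X i x.1 x.2 s ω), Finset.prod_sigma]

omit [IsProbabilityMeasure P] in
theorem IsBatchNetwork.indepFun_batch_routes (hnet : IsBatchNetwork P lam batchLaw q T B X)
    (i : ℕ) (s : ℝ≥0) (z : Fin J → ℝ) :
    IndepFun (B i) (fun ω (x : (_ : Fin J) × ℕ) => routeWeight z (X i x.1 x.2 s ω)) P := by
  rw [IndepFun_iff_Indep]
  have hd : Disjoint ({.batch i} : Set (Source J)) {.batch i}ᶜ := disjoint_compl_right
  refine indep_of_indep_of_le (indep_iSup_of_disjoint hnet.sourceAlgebra_le hnet.indep hd) ?_ ?_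
  · exact le_biSup (sourceAlgebra T B X) (i := .batch i) (Set.mem_singleton _)
  · refine measurable_iff_comap_le.1 (@measurable_pi_lambda _ _ _ (_) _ _ fun x => ?_)
    have hle : pathAlgebra (X i x.1 x.2)
        ≤ ⨆ y ∈ ({.batch i} : Set (Source J))ᶜ, sourceAlgebra T B X y :=
      le_biSup (sourceAlgebra T B X) (i := .customer i x.1 x.2) (by simp)
    exact (@measurable_routeWeight Ω J (pathAlgebra (X i x.1 x.2)) _
      (measurableSet_pathAlgebra _ s) z).mono hle le_rfl

theorem IsBatchNetwork.integral_prod_pow_batchOccupancy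
    (hnet : IsBatchNetwork P lam batchLaw q T B X) (i : ℕ) (s : ℝ≥0) {z : Fin J → ℝ}
    (hz : ∀ k, |z k| ≤ 1) :
    ∫ ω, ∏ k, z k ^ batchOccupancy B X i k s ω ∂P
      = ∫ b, ∏ j, (1 - ∑ k, q j k s * (1 - z k)) ^ b j ∂batchLaw := by
  simp_rw [prod_pow_batchOccupancy]
  have hV : Measurable fun ω (x : (_ : Fin J) × ℕ) => routeWeight z (X i x.1 x.2 s ω) :=
    measurable_pi_lambda _ fun x => measurable_routeWeight (hnet.route_measurable i _ _ s) z
  -- Clipping to `[-1, 1]` makes `Φ` bounded everywhere, as Fubini requires; it is inactive on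
  -- actual route weights.
  let Φ : (Fin J → ℕ) × ((_ : Fin J) × ℕ → ℝ) → ℝ := fun p =>
    ∏ j, ∏ l ∈ Finset.range (p.1 j), max (-1) (min 1 (p.2 ⟨j, l⟩))
  have hΦ : Measurable Φ := by
    refine measurable_from_prod_countable_right fun b => ?_
    change Measurable fun y : (_ : Fin J) × ℕ → ℝ =>
      ∏ j, ∏ l ∈ Finset.range (b j), max (-1) (min 1 (y ⟨j, l⟩))
    refine Finset.measurable_fun_prod _ fun j _ => Finset.measurable_fun_prod _ fun l _ => ?_
    exact measurable_const.max (measurable_const.min (measurable_pi_apply _))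
  have hb : ∀ p, ‖Φ p‖ ≤ 1 := fun p => by
    simp only [Φ, norm_prod]
    refine Finset.prod_le_one (fun _ _ => Finset.prod_nonneg fun _ _ => norm_nonneg _) fun j _ =>
      Finset.prod_le_one (fun _ _ => norm_nonneg _) fun l _ => ?_
    rw [Real.norm_eq_abs, abs_le]
    exact ⟨le_max_left _ _, max_le (by norm_num) (min_le_left _ _)⟩
  have hclip : ∀ ω j l, max (-1) (min 1 (routeWeight z (X i j l s ω)))
      = routeWeight z (X i j l s ω) := fun ω j l => by
    have := abs_le.1 (norm_routeWeight_le hz (X i j l s ω))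
    rw [min_eq_right this.2, max_eq_right this.1]
  have h := integral_comp_prodMk_of_indepFun (hnet.batch_measurable i) hV
    (hnet.indepFun_batch_routes i s z) hΦ hb
  simp only [Φ, hclip, hnet.integral_prod_routeWeight] at h
  rw [h, ← hnet.batch_law i, integral_map (hnet.batch_measurable i).aemeasurable .of_discrete]

omit [IsProbabilityMeasure P] in
theorem IsBatchNetwork.measurable_batchOccupancy (hnet : IsBatchNetwork P lam batchLaw q T B X)
    (i : ℕ) (k : Fin J) (s : ℝ≥0) : Measurable (batchOccupancy B X i k s) :=
  BatchQueue.measurable_batchOccupancy (hnet.batch_measurable i)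
    (fun j l => hnet.route_measurable i j l s) k

/-- The probability generating function of the number of customers of a batch in each queue. -/
theorem IsBatchNetwork.integral_prod_pow_eq (hnet : IsBatchNetwork P lam batchLaw q T B X)
    {p : Fin J → ℝ} (hp : ∀ j, 0 ≤ p j) (hp_sum : ∑ j, p j = 1) {μ : Measure ℕ} {ν r : ℝ}
    (hν : 0 < ν) (hμ : IsNegBinomial μ ν r) (hbatch : IsUnivariateBatch batchLaw μ p)
    (i : ℕ) (s : ℝ≥0) {z : Fin J → ℝ} (hz : ∀ k, |z k| ≤ 1) :
    ∫ ω, ∏ k, z k ^ batchOccupancy B X i k s ω ∂P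
      = ((1 + ∑ k, ν * mixedOccupancy p q k s) - ∑ k, ν * mixedOccupancy p q k s * z k) ^ (-r) := by
  -- `w j` is the mean weight of a customer entering at queue `j`. As the mean of a quantity bounded
  -- by `1` it is a legal argument of the batch generating function.
  let w : Fin J → ℝ := fun j => 1 - ∑ k, q j k s * (1 - z k)
  have hw : ∀ j, |w j| ≤ 1 := fun j => by
    simp only [w]
    rw [← hnet.integral_routeWeight i j 0 s z, ← Real.norm_eq_abs]
    refine (norm_integral_le_of_norm_le_const (C := 1)
      (Filter.Eventually.of_forall fun ω => norm_routeWeight_le hz _)).trans ?_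
    simp
  have hsum : ∑ j, p j * w j = 1 - ∑ k, mixedOccupancy p q k s * (1 - z k) := by
    simp only [w, mul_sub, mul_one, Finset.sum_sub_distrib, hp_sum, mixedOccupancy,
      Finset.mul_sum, Finset.sum_mul]
    congr 1
    rw [Finset.sum_comm, Finset.sum_comm (f := fun k j => p j * q j k s * z k)]
    simp only [mul_assoc]
  have hle : |∑ j, p j * w j| ≤ 1 := by
    refine (Finset.abs_sum_le_sum_abs _ _).trans ?_
    rw [← hp_sum]
    refine Finset.sum_le_sum fun j _ => ?_
    rw [abs_mul, abs_of_nonneg (hp j)]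
    exact mul_le_of_le_one_right (hp j) (hw j)
  have hpos : 0 < 1 + ν * (1 - ∑ j, p j * w j) := by
    have := (abs_le.1 hle).2
    have := mul_nonneg hν.le (sub_nonneg.2 this)
    linarith
  rw [hnet.integral_prod_pow_batchOccupancy i s hz]
  have h1 := hbatch (fun j => (w j : ℂ)) fun j => by simpa using hw j
  have hcast : ∑ j, (p j : ℂ) * (w j : ℂ) = ((∑ j, p j * w j : ℝ) : ℂ) := by push_cast; rfl
  rw [hcast, hμ _ (by rw [Complex.norm_real]; exact hle), multiPGF] at h1
  have h2 : ∫ b, ∏ j, (w j : ℂ) ^ b j ∂batchLaw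
      = ((∫ b, ∏ j, w j ^ b j ∂batchLaw : ℝ) : ℂ) := by
    rw [← integral_complex_ofReal]
    push_cast
    rfl
  -- The base is a positive real, so the complex power is the real one.
  have h3 : (1 : ℂ) / (1 + (ν : ℂ) * (1 - ((∑ j, p j * w j : ℝ) : ℂ))) ^ (r : ℂ)
      = (((1 + ν * (1 - ∑ j, p j * w j)) ^ (-r) : ℝ) : ℂ) := by
    rw [Real.rpow_neg hpos.le, Complex.ofReal_inv, Complex.ofReal_cpow hpos.le, one_div]
    push_cast
    rfl
  rw [h2, h3, Complex.ofReal_inj] at h1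
  rw [h1, hsum]
  congr 1
  simp only [mul_sub, mul_one, Finset.sum_sub_distrib, Finset.mul_sum, mul_assoc]
  ring

omit [IsProbabilityMeasure P] in
theorem IsBatchNetwork.mixedOccupancy_nonneg (hnet : IsBatchNetwork P lam batchLaw q T B X)
    {p : Fin J → ℝ} (hp : ∀ j, 0 ≤ p j) (k : Fin J) (s : ℝ≥0) : 0 ≤ mixedOccupancy p q k s :=
  Finset.sum_nonneg fun j _ => mul_nonneg (hp j) (by
    rw [← hnet.route_law 0 j 0 k s]
    exact measureReal_nonneg)

/-- The law of the number of customers of a batch in each queue is negative multinomial. -/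
theorem IsBatchNetwork.measureReal_batchOccupancy (hnet : IsBatchNetwork P lam batchLaw q T B X)
    {p : Fin J → ℝ} (hp : ∀ j, 0 ≤ p j) (hp_sum : ∑ j, p j = 1) {μ : Measure ℕ} {ν r : ℝ}
    (hν : 0 < ν) (hr : 0 < r) (hμ : IsNegBinomial μ ν r) (hbatch : IsUnivariateBatch batchLaw μ p)
    (i : ℕ) (s : ℝ≥0) (a : Fin J → ℕ) :
    P.real {ω | (fun k => batchOccupancy B X i k s ω) = a}
      = (Real.Gamma (r + ∑ k, (a k : ℝ)) / (Real.Gamma r * ∏ k, ((a k).factorial : ℝ))) *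
        (∏ k, (ν * mixedOccupancy p q k s) ^ a k) *
        (1 + ∑ k, ν * mixedOccupancy p q k s) ^ (-(r + ∑ k, (a k : ℝ))) := by
  have hC : Measurable fun ω k => batchOccupancy B X i k s ω :=
    measurable_pi_lambda _ fun k => hnet.measurable_batchOccupancy i k s
  have h := coeff_eq_of_hasSum_negBinomial (A := 1 + ∑ k, ν * mixedOccupancy p q k s)
    (b := fun k => ν * mixedOccupancy p q k s)
    (fun k => mul_nonneg hν.le (hnet.mixedOccupancy_nonneg hp k s)) (by linarith) a
    (c := fun a => P.real {ω | (fun k => batchOccupancy B X i k s ω) = a}) (K := 1) hr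
    fun z hz => by
      rw [one_mul, ← hnet.integral_prod_pow_eq hp hp_sum hν hμ hbatch i s fun k => (hz k).le]
      refine hasSum_measureReal_fiber_mul hC (g := fun a : Fin J → ℕ => ∏ k, z k ^ a k) ?_
      refine Integrable.of_bound ((Measurable.of_discrete
        (f := fun a : Fin J → ℕ => ∏ k, z k ^ a k)).comp hC).aestronglyMeasurable 1
        (Filter.Eventually.of_forall fun ω => ?_)
      rw [norm_prod]
      refine Finset.prod_le_one (fun _ _ => norm_nonneg _) fun k _ => ?_
      rw [norm_pow]
      exact pow_le_one₀ (norm_nonneg _) (hz k).le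
  rw [one_mul] at h
  exact h

end BatchLaw

/-! ### Conditioning on the arrival epochs -/

open MvPowerSeries

/-- The generating function of the number of customers of a batch in each queue. -/
noncomputable def batchSeries {Ω : Type*} [MeasurableSpace Ω] (P : Measure Ω) {J : ℕ}
    (B : ℕ → Ω → Fin J → ℕ) (X : ℕ → Fin J → ℕ → ℝ≥0 → Ω → Option (Fin J)) (s : ℝ≥0) :
    MvPowerSeries (Fin J) ℝ :=
  fun a => P.real {ω | (fun k => batchOccupancy B X 0 k s ω) = a}

/-- The batch to which a source of randomness belongs. -/
def Source.batchIndex {J : ℕ} : Source J → Option ℕ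
  | .arrivals => none
  | .batch i => some i
  | .customer i _ _ => some i

/-- The sources of randomness of the batches with index in `S`. -/
def batchSources (J : ℕ) (S : Set ℕ) : Set (Source J) :=
  {x | ∃ i ∈ S, x.batchIndex = some i}

/-- The σ-algebra generated by all the batch vectors and all the routes. -/
@[reducible] def batchesAlgebra {Ω : Type*} {J : ℕ} (T : ℕ → Ω → ℝ≥0∞) (B : ℕ → Ω → Fin J → ℕ)
    (X : ℕ → Fin J → ℕ → ℝ≥0 → Ω → Option (Fin J)) : MeasurableSpace Ω :=
  ⨆ x ∈ batchSources J Set.univ, sourceAlgebra T B X x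

section JointMeasurability

variable {α β : Type*} [MeasurableSpace α] [MeasurableSpace β] {J : ℕ}

/-- Epochs and batch data live on separate factors so that conditioning becomes Fubini. The routes
are evaluated at the random age `t - T i`, hence the need for joint measurability. -/
theorem measurableSet_occupancy_eq {T : ℕ → α → ℝ≥0∞} {B : ℕ → β → Fin J → ℕ}
    {X : ℕ → Fin J → ℕ → ℝ≥0 → β → Option (Fin J)} (hT : ∀ i, Measurable (T i))
    (hB : ∀ i, Measurable (B i))
    (hX : ∀ i j l k, MeasurableSet {x : ℝ≥0 × β | X i j l x.1 x.2 = some k})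
    (t : ℝ≥0) (n : Fin J → ℕ) :
    MeasurableSet {x : α × β | ∀ k, occupancy (fun i (x : α × β) => T i x.1)
      (fun i (x : α × β) => B i x.2) (fun i j l s (x : α × β) => X i j l s x.2) k t x
        = (n k : ℝ≥0∞)} := by
  classical
  have hT' : ∀ i, Measurable fun x : α × β => T i x.1 := fun i => (hT i).comp measurable_fst
  have hocc : ∀ i k, Measurable fun x : α × β =>
      batchOccupancy B X i k (t - (T i x.1).toNNReal) x.2 := fun i k => by
    refine BatchQueue.measurable_batchOccupancy (B := fun i (x : α × β) => B i x.2)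
      (X := fun i j l _ (x : α × β) => X i j l (t - (T i x.1).toNNReal) x.2) (i := i) (s := 0)
      ((hB i).comp measurable_snd) (fun j l k => ?_) k
    exact (hX i j l k).preimage
      ((measurable_const.sub (hT' i).ennreal_toNNReal).prodMk measurable_snd)
  have : {x : α × β | ∀ k, occupancy (fun i (x : α × β) => T i x.1)
      (fun i (x : α × β) => B i x.2) (fun i j l s (x : α × β) => X i j l s x.2) k t x
        = (n k : ℝ≥0∞)} = ⋂ k, (fun x : α × β => ∑' i, if T i x.1 ≤ t then
          (batchOccupancy B X i k (t - (T i x.1).toNNReal) x.2 : ℝ≥0∞) else 0) ⁻¹'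
            {(n k : ℝ≥0∞)} := by
    ext x
    simp only [Set.mem_ofPred_eq, Set.mem_iInter, Set.mem_preimage, Set.mem_singleton_iff]
    refine forall_congr' fun k => ?_
    rw [occupancy]
    congr!
  rw [this]
  refine MeasurableSet.iInter fun k => Measurable.tsum (fun i => ?_) (measurableSet_singleton _)
  exact Measurable.ite (measurableSet_le (hT' i) measurable_const)
    ((Measurable.of_discrete (f := fun m : ℕ => (m : ℝ≥0∞))).comp (hocc i k)) measurable_const

end JointMeasurability

variable {Ω : Type*} [MeasurableSpace Ω] {P : Measure Ω} [IsProbabilityMeasure P]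
  {J : ℕ} {lam : ℝ → ℝ} {batchLaw : Measure (Fin J → ℕ)} {q : Fin J → Fin J → ℝ → ℝ}
  {T : ℕ → Ω → ℝ≥0∞} {B : ℕ → Ω → Fin J → ℕ}
  {X : ℕ → Fin J → ℕ → ℝ≥0 → Ω → Option (Fin J)}

omit [IsProbabilityMeasure P] in
theorem coeff_batchSeries (s : ℝ≥0) (a : Fin J →₀ ℕ) : coeff a (batchSeries P B X s)
    = P.real {ω | (fun k => batchOccupancy B X 0 k s ω) = a} := rfl

theorem IsBatchNetwork.isSubProb_batchSeries (hnet : IsBatchNetwork P lam batchLaw q T B X)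
    (s : ℝ≥0) : IsSubProb (batchSeries P B X s) := by
  refine ⟨fun a => measureReal_nonneg, fun S => ?_⟩
  have hC : Measurable fun ω k => batchOccupancy B X 0 k s ω :=
    measurable_pi_lambda _ fun k => hnet.measurable_batchOccupancy 0 k s
  simp_rw [coeff_batchSeries]
  rw [← measureReal_biUnion_finset]
  · exact measureReal_le_one
  · intro a _ b _ hab
    refine Set.disjoint_left.2 fun ω h1 h2 => hab (DFunLike.coe_injective ?_)
    exact h1.symm.trans h2
  · exact fun a _ => hC (measurableSet_singleton (a : Fin J → ℕ))

omit [MeasurableSpace Ω] in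
theorem measurable_batchOccupancy_batchSources (S : Set ℕ) {i : ℕ} (hi : i ∈ S) (s : ℝ≥0)
    (k : Fin J) : Measurable[⨆ x ∈ batchSources J S, sourceAlgebra T B X x]
      (batchOccupancy B X i k s) := by
  have hB : sourceAlgebra T B X (.batch i) ≤ ⨆ x ∈ batchSources J S, sourceAlgebra T B X x :=
    le_biSup (sourceAlgebra T B X) (i := .batch i) ⟨i, hi, rfl⟩
  refine @BatchQueue.measurable_batchOccupancy Ω J (_) B X i s
    (measurable_iff_comap_le.2 hB) (fun j l k => ?_) k
  have hX : sourceAlgebra T B X (.customer i j l)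
      ≤ ⨆ x ∈ batchSources J S, sourceAlgebra T B X x :=
    le_biSup (sourceAlgebra T B X) (i := .customer i j l) ⟨i, hi, rfl⟩
  exact hX _ (measurableSet_pathAlgebra _ s k)

omit [IsProbabilityMeasure P] in
theorem IsBatchNetwork.measureReal_inter (hnet : IsBatchNetwork P lam batchLaw q T B X)
    {i₀ : ℕ} {I : Finset ℕ} (hi : i₀ ∉ I) (s : ℕ → ℝ≥0) (a b : Fin J → ℕ) :
    P.real ({ω | (fun k => batchOccupancy B X i₀ k (s i₀) ω) = a} ∩
        {ω | (fun k => ∑ i ∈ I, batchOccupancy B X i k (s i) ω) = b})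
      = P.real {ω | (fun k => batchOccupancy B X i₀ k (s i₀) ω) = a} *
        P.real {ω | (fun k => ∑ i ∈ I, batchOccupancy B X i k (s i) ω) = b} := by
  have hd : Disjoint (batchSources J {i₀}) (batchSources J (I : Set ℕ)) := by
    refine Set.disjoint_left.2 ?_
    rintro x ⟨i, rfl, hx⟩ ⟨i', hi', hx'⟩
    rw [hx, Option.some_inj] at hx'
    exact hi (hx' ▸ hi')
  have hind := indep_iSup_of_disjoint hnet.sourceAlgebra_le hnet.indep hd
  have h1 : MeasurableSet[⨆ x ∈ batchSources J {i₀}, sourceAlgebra T B X x]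
      {ω | (fun k => batchOccupancy B X i₀ k (s i₀) ω) = a} :=
    @measurable_pi_lambda _ _ _ (_) _ _ (fun k =>
      measurable_batchOccupancy_batchSources {i₀} rfl (s i₀) k) _ (measurableSet_singleton a)
  have h2 : MeasurableSet[⨆ x ∈ batchSources J (I : Set ℕ), sourceAlgebra T B X x]
      {ω | (fun k => ∑ i ∈ I, batchOccupancy B X i k (s i) ω) = b} :=
    @measurable_pi_lambda _ _ _ (_) _ _ (fun k => @Finset.measurable_fun_sum _ _ _ _ _ _ (_) _ I
      fun i hi => measurable_batchOccupancy_batchSources (I : Set ℕ) hi (s i) k) _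
      (measurableSet_singleton b)
  rw [measureReal_def, (Indep_iff _ _ P).1 hind _ _ h1 h2, ENNReal.toReal_mul]
  rfl

/-- At fixed ages distinct batches are independent, so adding a batch convolves the laws and
multiplies the series. -/
theorem IsBatchNetwork.measureReal_sum_batchOccupancy
    (hnet : IsBatchNetwork P lam batchLaw q T B X)
    (hlaw : ∀ i s (a : Fin J →₀ ℕ), P.real {ω | (fun k => batchOccupancy B X i k s ω) = a}
      = coeff a (batchSeries P B X s))
    (I : Finset ℕ) (s : ℕ → ℝ≥0) (n : Fin J →₀ ℕ) :
    P.real {ω | (fun k => ∑ i ∈ I, batchOccupancy B X i k (s i) ω) = n}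
      = coeff n (∏ i ∈ I, batchSeries P B X (s i)) := by
  classical
  induction I using Finset.induction_on generalizing n with
  | empty =>
    simp only [Finset.sum_empty, Finset.prod_empty, coeff_one]
    split_ifs with h
    · subst h
      have : {ω : Ω | (fun _ : Fin J => 0) = ((0 : Fin J →₀ ℕ) : Fin J → ℕ)} = Set.univ :=
        Set.eq_univ_of_forall fun _ => rfl
      rw [this, probReal_univ]
    · have : {ω : Ω | (fun _ : Fin J => 0) = (n : Fin J → ℕ)} = ∅ :=
        Set.eq_empty_of_forall_notMem fun _ h0 => h (DFunLike.coe_injective h0.symm)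
      rw [this, measureReal_empty]
  | insert i₀ I hi ih =>
    have hm1 : ∀ a : Fin J → ℕ,
        MeasurableSet {ω | (fun k => batchOccupancy B X i₀ k (s i₀) ω) = a} := fun a =>
      measurable_pi_lambda _ (fun k => hnet.measurable_batchOccupancy i₀ k (s i₀))
        (measurableSet_singleton a)
    have hm2 : ∀ a : Fin J → ℕ,
        MeasurableSet {ω | (fun k => ∑ i ∈ I, batchOccupancy B X i k (s i) ω) = a} := fun a =>
      measurable_pi_lambda _ (fun k => Finset.measurable_fun_sum I fun i _ =>
        hnet.measurable_batchOccupancy i k (s i)) (measurableSet_singleton a)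
    have hset : {ω | (fun k => ∑ i ∈ insert i₀ I, batchOccupancy B X i k (s i) ω) = n}
        = ⋃ p ∈ Finset.HasAntidiagonal.antidiagonal n,
          ({ω | (fun k => batchOccupancy B X i₀ k (s i₀) ω) = p.1} ∩
            {ω | (fun k => ∑ i ∈ I, batchOccupancy B X i k (s i) ω) = p.2}) := by
      ext ω
      simp only [Set.mem_iUnion, Finset.HasAntidiagonal.mem_antidiagonal, Set.mem_inter_iff, Set.mem_ofPred_eq,
        Finset.sum_insert hi]
      constructor
      · intro h
        refine ⟨(Finsupp.equivFunOnFinite.symm fun k => batchOccupancy B X i₀ k (s i₀) ω,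
          Finsupp.equivFunOnFinite.symm fun k => ∑ i ∈ I, batchOccupancy B X i k (s i) ω),
          ?_, rfl, rfl⟩
        exact DFunLike.coe_injective h
      · rintro ⟨p, rfl, h1, h2⟩
        rw [Finsupp.coe_add, ← h1, ← h2]
        rfl
    rw [hset, measureReal_biUnion_finset]
    · rw [Finset.prod_insert hi, coeff_mul]
      refine Finset.sum_congr rfl fun p _ => ?_
      rw [hnet.measureReal_inter hi, hlaw, ih]
    · intro p _ p' _ hpp
      refine Set.disjoint_left.2 fun ω h h' => hpp (Prod.ext ?_ ?_)
      · exact DFunLike.coe_injective (h.1.symm.trans h'.1)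
      · exact DFunLike.coe_injective (h.2.symm.trans h'.2)
    · exact fun p _ => (hm1 _).inter (hm2 _)

omit [IsProbabilityMeasure P] in
theorem IsBatchNetwork.indep_arrivals (hnet : IsBatchNetwork P lam batchLaw q T B X) :
    Indep (sourceAlgebra T B X .arrivals)
      (batchesAlgebra T B X) P := by
  have hd : Disjoint ({.arrivals} : Set (Source J)) (batchSources J Set.univ) := by
    refine Set.disjoint_left.2 ?_
    rintro x rfl ⟨i, _, hx⟩
    cases hx
  exact indep_of_indep_of_le_left (indep_iSup_of_disjoint hnet.sourceAlgebra_le hnet.indep hd)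
    (le_biSup (sourceAlgebra T B X) (i := .arrivals) (Set.mem_singleton _))

-- With finitely many arrivals the defining series is a finite sum of natural numbers.
omit [MeasurableSpace Ω] in
theorem occupancy_eq_iff {α : Type*} (T : ℕ → α → ℝ≥0∞) (B : ℕ → Ω → Fin J → ℕ)
    (X : ℕ → Fin J → ℕ → ℝ≥0 → Ω → Option (Fin J)) (t : ℝ≥0) (n : Fin J → ℕ) (x : α × Ω)
    (hfin : {i | T i x.1 ≤ t}.Finite) :
    (∀ k, occupancy (fun i (x : α × Ω) => T i x.1) (fun i (x : α × Ω) => B i x.2)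
      (fun i j l s (x : α × Ω) => X i j l s x.2) k t x = (n k : ℝ≥0∞)) ↔
    (fun k => ∑ i ∈ arrivedBatches T t x.1,
      batchOccupancy B X i k (t - (T i x.1).toNNReal) x.2) = n := by
  classical
  rw [funext_iff]
  refine forall_congr' fun k => ?_
  have : occupancy (fun i (x : α × Ω) => T i x.1) (fun i (x : α × Ω) => B i x.2)
      (fun i j l s (x : α × Ω) => X i j l s x.2) k t x
      = ((∑ i ∈ arrivedBatches T t x.1,
        batchOccupancy B X i k (t - (T i x.1).toNNReal) x.2 : ℕ) : ℝ≥0∞) := by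
    rw [occupancy, tsum_eq_sum (s := arrivedBatches T t x.1), Nat.cast_sum]
    · refine Finset.sum_congr rfl fun i hi => ?_
      rw [if_pos ((mem_arrivedBatches hfin).1 hi)]
      rfl
    · intro i hi
      rw [if_neg fun h => hi ((mem_arrivedBatches hfin).2 h)]
  rw [this, Nat.cast_inj]

/-- Conditioning on the arrival epochs. -/
theorem IsBatchNetwork.occupancyPMF_eq_integral (hnet : IsBatchNetwork P lam batchLaw q T B X)
    (hlaw : ∀ i s (a : Fin J →₀ ℕ), P.real {ω | (fun k => batchOccupancy B X i k s ω) = a}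
      = coeff a (batchSeries P B X s)) (t : ℝ≥0) (n : Fin J →₀ ℕ) :
    occupancyPMF P T B X t n = ∫ ω, coeff n (∏ i ∈ arrivedBatches T t ω,
      batchSeries P B X (t - (T i ω).toReal.toNNReal)) ∂P := by
  have h₁ : sourceAlgebra T B X .arrivals ≤ ‹MeasurableSpace Ω› := hnet.sourceAlgebra_le _
  have h₂ : batchesAlgebra T B X ≤ ‹MeasurableSpace Ω› := iSup₂_le fun x _ => hnet.sourceAlgebra_le x
  have hT : ∀ i, Measurable[sourceAlgebra T B X .arrivals] (T i) := fun i =>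
    measurable_iff_comap_le.2 (le_iSup (fun i => MeasurableSpace.comap (T i) inferInstance) i)
  have hB : ∀ i, Measurable[batchesAlgebra T B X] (B i) := fun i => measurable_iff_comap_le.2
    (le_biSup (sourceAlgebra T B X) (i := .batch i) ⟨i, trivial, rfl⟩)
  have hX : ∀ i j l k, MeasurableSet[(inferInstance : MeasurableSpace ℝ≥0).prod (batchesAlgebra T B X)]
      {x : ℝ≥0 × Ω | X i j l x.1 x.2 = some k} := fun i j l k => by
    have hle : pathAlgebra (X i j l) ≤ batchesAlgebra T B X :=
      le_biSup (sourceAlgebra T B X) (i := .customer i j l) ⟨i, trivial, rfl⟩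
    exact (sup_le_sup le_rfl (MeasurableSpace.comap_mono hle) :
      (inferInstance : MeasurableSpace ℝ≥0).prod (pathAlgebra (X i j l))
        ≤ (inferInstance : MeasurableSpace ℝ≥0).prod (batchesAlgebra T B X)) _ (hnet.route_jointly_measurable i j l k)
  have hD := @measurableSet_occupancy_eq Ω Ω (sourceAlgebra T B X .arrivals) (batchesAlgebra T B X) J T B X hT hB hX t n
  -- Both factors are `Ω` itself, with the σ-algebras of the arrivals and of the batches; the
  -- original event is the pullback along the diagonal.
  have hind : @IndepFun Ω Ω Ω _ (sourceAlgebra T B X .arrivals) (batchesAlgebra T B X) id id P := by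
    rw [@IndepFun_iff_Indep]
    simpa only [MeasurableSpace.comap_id] using hnet.indep_arrivals
  have key := @measureReal_prodMk_of_indepFun Ω _ P _ Ω Ω (sourceAlgebra T B X .arrivals) (batchesAlgebra T B X) id id
    (measurable_id'' h₁) (measurable_id'' h₂) hind _ hD
  refine Eq.trans key (integral_congr_ae ?_)
  filter_upwards [hnet.arrivals.ae_finite t] with ω hω
  rw [← hnet.measureReal_sum_batchOccupancy hlaw (arrivedBatches T t ω)
    fun i => t - (T i ω).toReal.toNNReal]
  have hTr : ∀ i, (T i ω).toReal.toNNReal = (T i ω).toNNReal := fun i => Real.toNNReal_coe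
  simp only [hTr]
  congr 1
  ext ω'
  exact occupancy_eq_iff T B X t n (ω, ω') hω

/-- Sections of a jointly measurable set have measurable probabilities, which gives measurability of
`q` in time. -/
theorem IsBatchNetwork.measurable_mixedOccupancy (hnet : IsBatchNetwork P lam batchLaw q T B X)
    (p : Fin J → ℝ) (k : Fin J) : Measurable fun s : ℝ≥0 => mixedOccupancy p q k s := by
  refine Finset.measurable_fun_sum _ fun j _ => Measurable.const_mul ?_ _
  have hle : (inferInstance : MeasurableSpace ℝ≥0).prod (pathAlgebra (X 0 j 0))
      ≤ (inferInstance : MeasurableSpace (ℝ≥0 × Ω)) :=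
    sup_le_sup le_rfl (MeasurableSpace.comap_mono (pathAlgebra_le (hnet.route_measurable 0 j 0)))
  have h := measurable_measure_prodMk_left (ν := P)
    (hle _ (hnet.route_jointly_measurable 0 j 0 k))
  simp_rw [← hnet.route_law 0 j 0 k]
  exact h.ennreal_toReal

/-! ### The explicit kernel, the index set and the final recursion -/

omit [IsProbabilityMeasure P] [MeasurableSpace Ω] in
theorem negBinomialKernel_eq (ν r : ℝ) (v : Fin J) {i : Fin J → ℕ} (hi : ∀ k, v < k → i k = 0)
    {a : Fin J → ℝ} (ha : 0 < 1 + ν * ∑ k, a k) :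
    negBinomialKernel ν r v i a
      = (Real.Gamma (r + ∑ k, (i k : ℝ)) / (Real.Gamma r * ∏ k, ((i k).factorial : ℝ))) *
        (∏ k, (ν * a k) ^ i k) * (1 + ∑ k, ν * a k) ^ (-(r + ∑ k, (i k : ℝ))) := by
  have h0 : ∀ k ∈ Finset.univ, k ∉ Finset.Iic v → i k = 0 := fun k _ hk =>
    hi k (not_le.1 fun h => hk (Finset.mem_Iic.2 h))
  have hsub : Finset.Iic v ⊆ Finset.univ := Finset.subset_univ _
  have e1 : ∑ k ∈ Finset.Iic v, (i k : ℝ) = ∑ k, (i k : ℝ) :=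
    Finset.sum_subset hsub fun k hk hk' => by simp [h0 k hk hk']
  have e2 : ∑ k ∈ Finset.Iic v, i k = ∑ k, i k := Finset.sum_subset hsub h0
  have e3 : ∏ k ∈ Finset.Iic v, ((i k).factorial : ℝ) = ∏ k, ((i k).factorial : ℝ) :=
    Finset.prod_subset hsub fun k hk hk' => by simp [h0 k hk hk']
  have e4 : ∏ k ∈ Finset.Iic v, a k ^ i k = ∏ k, a k ^ i k :=
    Finset.prod_subset hsub fun k hk hk' => by simp [h0 k hk hk']
  have e5 : ∏ k, (ν * a k) ^ i k = ν ^ (∑ k, i k) * ∏ k, a k ^ i k := by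
    simp_rw [mul_pow]
    rw [Finset.prod_mul_distrib, Finset.prod_pow_eq_pow_sum]
  rw [negBinomialKernel, e1, e2, e3, e4, e5, ← Finset.mul_sum, Real.rpow_neg ha.le]
  ring

/-- A sum over the pairs `(n - i, i)`, as a sum over the `i` with `i_v ≥ 1`. -/
theorem sum_antidiagonal_eq_sum_Icc {v : Fin J} (n : Fin J → ℕ) (F : (Fin J → ℕ) → (Fin J → ℕ) → ℝ)
    (hF : ∀ a b, b v = 0 → F a b = 0) :
    ∑ p ∈ Finset.HasAntidiagonal.antidiagonal (Finsupp.equivFunOnFinite.symm n), F p.1 p.2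
      = ∑ i ∈ Finset.Icc (Pi.single v 1) n, F (n - i) i := by
  classical
  rw [← Finset.sum_filter_of_ne (p := fun p : (Fin J →₀ ℕ) × (Fin J →₀ ℕ) => p.2 v ≠ 0)
    fun p _ hp h => hp (hF _ _ h)]
  refine Finset.sum_nbij' (fun p => (p.2 : Fin J → ℕ))
    (fun i => (Finsupp.equivFunOnFinite.symm (n - i), Finsupp.equivFunOnFinite.symm i)) ?_ ?_ ?_ ?_ ?_
  · intro p hp
    obtain ⟨h1, h2⟩ := Finset.mem_filter.1 hp
    have h1 := DFunLike.ext_iff.1 (Finset.HasAntidiagonal.mem_antidiagonal.1 h1)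
    refine Finset.mem_Icc.2 ⟨fun k => ?_, fun k => ?_⟩
    · rcases eq_or_ne k v with rfl | hk
      · rw [Pi.single_eq_same]
        exact Nat.one_le_iff_ne_zero.2 h2
      · simp [hk]
    · have : p.1 k + p.2 k = n k := h1 k
      change p.2 k ≤ n k
      omega
  · intro i hi
    obtain ⟨h1, h2⟩ := Finset.mem_Icc.1 hi
    refine Finset.mem_filter.2 ⟨Finset.HasAntidiagonal.mem_antidiagonal.2 ?_, ?_⟩
    · ext k
      exact Nat.sub_add_cancel (h2 k)
    · have := h1 v
      rw [Pi.single_eq_same] at this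
      exact Nat.one_le_iff_ne_zero.1 this
  · intro p hp
    have h1 := DFunLike.ext_iff.1
      (Finset.HasAntidiagonal.mem_antidiagonal.1 (Finset.mem_filter.1 hp).1)
    refine Prod.ext (Finsupp.ext fun k => ?_) (Finsupp.ext fun k => rfl)
    have : p.1 k + p.2 k = n k := h1 k
    change n k - p.2 k = p.1 k
    omega
  · intro i _
    rfl
  · intro p hp
    have h1 := DFunLike.ext_iff.1
      (Finset.HasAntidiagonal.mem_antidiagonal.1 (Finset.mem_filter.1 hp).1)
    congr 1
    funext k
    have : p.1 k + p.2 k = n k := h1 k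
    change p.1 k = n k - p.2 k
    omega

end BatchQueue

theorem corollary5p4
    {Ω : Type*} [MeasurableSpace Ω] (P : Measure Ω) [IsProbabilityMeasure P]
    {J : ℕ} (lam : ℝ → ℝ) (batchLaw : Measure (Fin J → ℕ)) (q : Fin J → Fin J → ℝ → ℝ)
    (T : ℕ → Ω → ℝ≥0∞) (B : ℕ → Ω → Fin J → ℕ)
    (X : ℕ → Fin J → ℕ → ℝ≥0 → Ω → Option (Fin J))
    (hnet : BatchQueue.IsBatchNetwork P lam batchLaw q T B X)
    (p : Fin J → ℝ) (hp : ∀ j, 0 ≤ p j) (hp_sum : ∑ j, p j = 1)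
    (μ : Measure ℕ) [IsProbabilityMeasure μ] (ν r : ℝ) (hν : 0 < ν) (hr : 0 < r)
    (hμ : BatchQueue.IsNegBinomial μ ν r)
    (hbatch : BatchQueue.IsUnivariateBatch batchLaw μ p)
    (t : ℝ≥0) (v : Fin J) (n : Fin J → ℕ) (hnv : 1 ≤ n v) (hn : ∀ k, v < k → n k = 0) :
    (∀ i ∈ Finset.Icc (Pi.single v 1) n,
      IntervalIntegrable
        (fun τ => lam τ * BatchQueue.negBinomialKernel ν r v i
          (fun k => BatchQueue.mixedOccupancy p q k (t - τ))) volume 0 t) ∧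
    BatchQueue.occupancyPMF P T B X t n =
      ∑ i ∈ Finset.Icc (Pi.single v 1) n,
        (i v : ℝ) / (n v : ℝ) * BatchQueue.occupancyPMF P T B X t (n - i) *
          ∫ τ in (0 : ℝ)..t, lam τ * BatchQueue.negBinomialKernel ν r v i
            (fun k => BatchQueue.mixedOccupancy p q k (t - τ)) := by
  open BatchQueue MvPowerSeries in
  have hform := hnet.measureReal_batchOccupancy hp hp_sum hν hr hμ hbatch
  -- The explicit formula does not mention the batch, so batch `0` represents them all.
  have hlaw : ∀ i s (a : Fin J →₀ ℕ), P.real {ω | (fun k => batchOccupancy B X i k s ω) = a}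
      = coeff a (batchSeries P B X s) := fun i s a => by
    rw [coeff_batchSeries, hform, hform]
  let f : ℝ → MvPowerSeries (Fin J) ℝ := fun τ => batchSeries P B X (t - τ.toNNReal)
  have hsub : ∀ τ, IsSubProb (f τ) := fun τ => hnet.isSubProb_batchSeries _
  have hmeas : ∀ a, Measurable fun τ => coeff a (f τ) := fun a => by
    have hq : ∀ k, Measurable fun τ : ℝ =>
        ν * mixedOccupancy p q k ((t - τ.toNNReal : ℝ≥0) : ℝ) := fun k =>
      ((hnet.measurable_mixedOccupancy p k).comp
        (measurable_const.sub measurable_real_toNNReal)).const_mul ν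
    simp only [f, coeff_batchSeries, hform]
    refine Measurable.mul (measurable_const.mul
      (Finset.measurable_fun_prod _ fun k _ => (hq k).pow_const _)) ?_
    exact (measurable_const.add (Finset.measurable_fun_sum _ fun k _ => hq k)).pow_const _
  have hlam := hnet.arrivals.rate_integrable t t.2
  -- Both truncations in `t - τ.toNNReal` are harmless on `[0, t]`, and `i ≤ n` makes `i` vanish
  -- beyond `v`.
  have hkernel : ∀ i : Fin J → ℕ, i ≤ n → Set.EqOn
      (fun τ => lam τ * coeff (Finsupp.equivFunOnFinite.symm i) (f τ))
      (fun τ => lam τ * negBinomialKernel ν r v i fun k => mixedOccupancy p q k (t - τ))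
      (Set.Icc 0 (t : ℝ)) := fun i hi τ hτ => by
    have hcast : ((t - τ.toNNReal : ℝ≥0) : ℝ) = t - τ := by
      rw [NNReal.coe_sub (Real.toNNReal_le_iff_le_coe.2 hτ.2), Real.coe_toNNReal _ hτ.1]
    have hpos : 0 < 1 + ν * ∑ k, mixedOccupancy p q k (t - τ) := by
      have := Finset.sum_nonneg fun k (_ : k ∈ Finset.univ) =>
        hnet.mixedOccupancy_nonneg hp k (t - τ.toNNReal)
      rw [hcast] at this
      positivity
    have h0 : ∀ k, v < k → i k = 0 := fun k hk => Nat.eq_zero_of_le_zero ((hi k).trans (hn k hk).le)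
    simp only [f, coeff_batchSeries, hform, hcast, negBinomialKernel_eq ν r v h0 hpos]
    rfl
  have hint : ∀ i : Fin J → ℕ, i ≤ n →
      ∫ τ in Set.Icc 0 (t : ℝ), lam τ * coeff (Finsupp.equivFunOnFinite.symm i) (f τ)
        = ∫ τ in (0 : ℝ)..t, lam τ * negBinomialKernel ν r v i
            fun k => mixedOccupancy p q k (t - τ) := fun i hi => by
    rw [setIntegral_congr_fun measurableSet_Icc (hkernel i hi),
      intervalIntegral.integral_of_le t.coe_nonneg, integral_Icc_eq_integral_Ioc]
  refine ⟨fun i hi => ?_, ?_⟩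
  · rw [intervalIntegrable_iff_integrableOn_Icc_of_le t.coe_nonneg]
    refine IntegrableOn.congr_fun ?_ (hkernel i (Finset.mem_Icc.1 hi).2) measurableSet_Icc
    exact hlam.mul_bdd (c := 1) (hmeas _).aestronglyMeasurable
      (Filter.Eventually.of_forall fun τ => (hsub τ).norm_coeff_le_one _)
  · have hpmf := hnet.occupancyPMF_eq_integral hlaw t
    have hrec := hnet.arrivals.recursion hmeas hsub t v (Finsupp.equivFunOnFinite.symm n)
    have hnv0 : (n v : ℝ) ≠ 0 := by exact_mod_cast Nat.one_le_iff_ne_zero.1 hnv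
    rw [HasPoissonRecursion] at hrec
    simp only [f, ← hpmf] at hrec
    -- The factor `b v` from the Euler operator kills the terms with `b v = 0`, so the sum starts at
    -- `i v = 1`.
    have hsum := sum_antidiagonal_eq_sum_Icc (v := v) n (fun a b => occupancyPMF P T B X t a *
      ((b v : ℝ) * ∫ τ in Set.Icc 0 (t : ℝ),
        lam τ * coeff (Finsupp.equivFunOnFinite.symm b) (f τ))) fun a b hb => by simp [hb]
    refine mul_left_cancel₀ hnv0 ((hrec.trans (Eq.trans ?_ hsum)).trans ?_)
    · refine Finset.sum_congr (by congr!) fun p _ => ?_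
      simp [f]
    · rw [Finset.mul_sum]
      refine Finset.sum_congr rfl fun i hi => ?_
      rw [hint i (Finset.mem_Icc.1 hi).2]
      field_simp
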